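/- **Conventions.** All objects $X$ have an underlying standard Borel space $\underline X$; for a finite ordered tuple (profile) $\mathbf A=(A_1,\dots,A_m)$ of objects, $\underline{\mathbf A}=\prod_r\underline{A_r}$ with the product $\sigma$-algebra (a point if $m=0$). A kernel $k:\mathbf A\to\mathbf B$ is a Markov kernel from $\underline{\mathbf A}$ to $\underline{\mathbf B}$. Given $k:\mathbf A\to\mathbf B$, $l:\mathbf C\to\mathbf D$ and slots $i$ of $\mathbf B=(B_1,\dots,B_n)$, $j$ of $\mathbf C=(C_1,\dots,C_q)$, put $$\boldsymbol\Gamma=(C_1,\dots,C_{j-1},\mathbf A,C_{j+1},\dots,C_q),\qquad \boldsymbol\Delta=(B_1,\dots,B_{i-1},\mathbf D,B_{i+1},\dots,B_n).$$ Let $V_j(\mathbf a,\mathbf c_{-j})\in\underline{\boldsymbol\Gamma}$ and $U_i(\mathbf b_{-i},\mathbf d)\in\underline{\boldsymbol\Delta}$ be the evident tuples in these orders, where $\mathbf c_{-j}$, $\mathbf b_{-i}$ omit the $j$-th, resp. $i$-th, coordinate, and let $T_j(\mathbf c_{-j},z)\in\underline{\mathbf C}$ insert $z$ in slot $j$. If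 $B_i=C_j$, the kernel slotwise composite $l\circ_{(i,j)}k:\boldsymbol\Gamma\to\boldsymbol\Delta$ is $$(l\circ_{(i,j)}k)(E\mid V_j(\mathbf a,\mathbf c_{-j}))=\int\!\!\int \mathbf 1_E(U_i(\mathbf b_{-i},\mathbf d))\,l(d\mathbf d\mid T_j(\mathbf c_{-j},b_i))\,k(d\mathbf b\mid\mathbf a).$$ **Colored Markov polycategories (CMPs).** A color system consists of a category $\mathcal K$ of object colors, an ordered polycategory $\mathcal M$ whose objects are those of $\mathcal K$, and a map $\iota$ sending each $f:c\to d$ in $\mathcal K$ to a morphism $(c)\to(d)$ of $\mathcal M$, compatibly with identities and composition. A CMP $\mathcal P$ consists of: a collection of objects; for all profiles a set of Markov kernels $\mathbf A\to\mathbf B$ (the morphisms), containing the identity kernels and closed under slotwise composition; object colors $\chi(X)\in\mathrm{Ob}(\mathcal K)$; morphism colors $\psi(k)\in\mathrm{Hom}_{\mathcal M}(\chi(\mathbf A);\chi(\mathbf B))$ compatible with identities and slotwise composition; and for all objects $B,C$ a set $\mathrm{Int}_{\mathcal P}(B,C)\subseteq\mathrm{Hom}_{\mathcal K}(\chi(B),\chi(C))$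 of admissible interface witnesses, with interface kernels $\kappa_{f;B,C}:(B)\to(C)$ that are morphisms of $\mathcal P$ of color $\iota(f)$, such that $\mathrm{id}_{\chi(B)}$ is admissible with $\kappa_{\mathrm{id};B,B}=\mathrm{id}_B$, and composites of admissible witnesses are admissible with $\kappa_{g f;B,D}=\kappa_{g;C,D}\circ\kappa_{f;B,C}$. **Diagrams.** A finite acyclic CKSC diagram $D$ in $\mathcal P$ has finitely many vertices $u$, each labelled by a morphism $k_u:\mathbf A_u\to\mathbf B_u$ of $\mathcal P$, and finitely many internal wires, each going from an output slot $(u,p)$ to an input slot $(v,q)$ and labelled by a witness in $\mathrm{Int}_{\mathcal P}(B_{u,p},A_{v,q})$; each slot is on at most one internal wire, the directed graph on the vertices given by the wires is acyclic, and the remaining (external) input slots and output slots are arranged in ordered lists, with profiles $\mathbf I_D$ and $\mathbf O_D$. Its interface expansion $\widehat D$ replaces each wire with witness $f$ from an object $B$ to an object $C$ by a unary vertex labelled $\kappa_{f;B,C}$, connected to the two ends of the wire. The trace kernel $K_D:\mathbf I_D\to\mathbf O_D$ is obtained by sampling, for a given external input value, the vertices of $\widehat D$ along a topological ordering, each output from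 the vertex kernel evaluated at its input tuple (read off from the external input and the earlier outputs), and taking the law of the tuple of external output values. **Proposition.** Let $D_1$ and $D_2$ be finite acyclic CKSC diagrams in a CMP $\mathcal P$. Suppose that the $i$-th external output object of $D_1$ is $B$ and the $j$-th external input object of $D_2$ is $C$, and let $f\in\mathrm{Int}_{\mathcal P}(B,C)$. Let $D$ be the diagram obtained from the disjoint union of $D_1$ and $D_2$ by adding one internal wire with witness $f$ from the $i$-th external output slot of $D_1$ to the $j$-th external input slot of $D_2$; its external input list is that of $D_2$ with the $j$-th entry replaced by the external input list of $D_1$, and its external output list is that of $D_1$ with the $i$-th entry replaced by the external output list of $D_2$. Then $$K_D=K_{D_2}\circ^f_{(i,j)}K_{D_1},$$ where, for $k:\mathbf A\to\mathbf B$ with $B_i=B$ and $l:\mathbf C\to\mathbf D$ with $C_j=C$, the kernel $l\circ^f_{(i,j)}k:\boldsymbol\Gamma\to\boldsymbol\Delta$ is given by $$(l\circ^f_{(i,j)}k)(E\mid V_j(\mathbf a,\mathbf c_{-j}))=\int_{\underline{\mathbf B}}\int_{\underline C}\int_{\underline{\mathbf D}}\mathbf 1_E(U_i(\mathbf b_{-i},\mathbf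 d))\,l(d\mathbf d\mid T_j(\mathbf c_{-j},z))\,\kappa_{f;B,C}(dz\mid b_i)\,k(d\mathbf b\mid\mathbf a).$$ -/

import Mathlib

open CategoryTheory MeasureTheory ProbabilityTheory

universe u v w uK vK wM

namespace MarkovPoly

/-! ### Ordered profiles -/

/-- Substitution of profiles: `plug C j A = (C_1, ..., C_{j-1}, A_1, ..., A_m, C_{j+1}, ..., C_q)`
(slots are numbered from `0`). -/
def plug {α : Type u} (C : List α) (j : Fin C.length) (A : List α) : List α :=
  C.take j ++ A ++ C.drop (j + 1)

theorem plug_length {α : Type u} (C : List α) (j : Fin C.length) (A : List α) :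
    (plug C j A).length = j + A.length + (C.length - (j + 1)) := by
  have := j.isLt
  simp only [plug, List.length_append, List.length_take, List.length_drop]
  omega

/-- The slots of `plug C j A` are the slots of `A` together with the slots of `C` other than `j`,
placed in the order displayed in `plug`. -/
def plugEquiv {α : Type u} (C : List α) (j : Fin C.length) (A : List α) :
    Fin A.length ⊕ {s : Fin C.length // s ≠ j} ≃ Fin (plug C j A).length where
  toFun x := match x with
    | Sum.inl s => ⟨j + s, by rw [plug_length]; omega⟩
    | Sum.inr s =>
        if h : s.1 < j then ⟨s.1, by rw [plug_length]; have : (s.1 : ℕ) < j := h; omega⟩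
        else ⟨s.1 - 1 + A.length, by
          rw [plug_length]
          have h1 : ¬ (s.1 : ℕ) < j := h
          have h2 : (s.1 : ℕ) ≠ j := fun h3 => s.2 (Fin.ext h3)
          omega⟩
  invFun r :=
    if h : (r : ℕ) < j then
      Sum.inr ⟨⟨r, by omega⟩, fun h3 => by
        have := congrArg Fin.val h3
        simp only at this
        omega⟩
    else if h' : (r : ℕ) < j + A.length then Sum.inl ⟨r - j, by omega⟩
    else Sum.inr ⟨⟨r - A.length + 1, by
        have := r.isLt
        have := plug_length C j A
        have := j.isLt
        omega⟩, fun h3 => by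
        have := congrArg Fin.val h3
        simp only at this
        omega⟩
  left_inv x := by
    rcases x with s | s
    · have h1 : ¬ ((j : ℕ) + s < j) := by omega
      have h2 : (j : ℕ) + s < j + A.length := by omega
      simp
    · have h2 : (s.1 : ℕ) ≠ j := fun h3 => s.2 (Fin.ext h3)
      by_cases h : s.1 < j
      · simp [h]
      · have h0 : ¬ (s.1 : ℕ) < j := h
        have h3 : ¬ ((s.1 : ℕ) - 1 + A.length < j) := by omega
        have h4 : ¬ ((s.1 : ℕ) - 1 + A.length < j + A.length) := by omega
        simp only [h, dite_false, h3, h4]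
        congr 1
        apply Subtype.ext
        apply Fin.ext
        simp only
        omega
  right_inv r := by
    by_cases h : (r : ℕ) < j
    · have h0 : (⟨r, by omega⟩ : Fin C.length) < j := h
      simp [h, h0]
    · by_cases h' : (r : ℕ) < j + A.length
      · simp only [h, dite_false, h', dite_true]
        apply Fin.ext
        simp only
        omega
      · have h0 : ¬ ((⟨r - A.length + 1, by
            have := r.isLt
            have := plug_length C j A
            have := j.isLt
            omega⟩ : Fin C.length) < j) := by
          rw [Fin.lt_def]
          simp only
          omega
        simp only [h, dite_false, h', h0]
        apply Fin.ext
        simp only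
        omega

theorem plug_get_inl {α : Type u} (C : List α) (j : Fin C.length) (A : List α)
    (s : Fin A.length) : (plug C j A).get (plugEquiv C j A (Sum.inl s)) = A.get s := by
  have hv : ((plugEquiv C j A (Sum.inl s)) : ℕ) = j + s := rfl
  have := j.isLt
  rw [List.get_eq_getElem]
  simp only [hv]
  simp only [plug, List.get_eq_getElem]
  rw [List.getElem_append_left (by simp), List.getElem_append_right (by simp)]
  congr 1
  simp

theorem plug_get_inr {α : Type u} (C : List α) (j : Fin C.length) (A : List α)
    (s : {s : Fin C.length // s ≠ j}) :
    (plug C j A).get (plugEquiv C j A (Sum.inr s)) = C.get s.1 := by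
  have := j.isLt
  have := s.1.isLt
  have h2 : (s.1 : ℕ) ≠ j := fun h3 => s.2 (Fin.ext h3)
  rw [List.get_eq_getElem]
  by_cases h : s.1 < j
  · have h0 : (s.1 : ℕ) < j := h
    have hv : ((plugEquiv C j A (Sum.inr s)) : ℕ) = s.1 := by simp [plugEquiv, h]
    simp only [hv]
    simp only [plug, List.get_eq_getElem]
    rw [List.getElem_append_left (by simp; omega), List.getElem_append_left (by simp; omega)]
    simp
  · have h0 : ¬ (s.1 : ℕ) < j := h
    have hv : ((plugEquiv C j A (Sum.inr s)) : ℕ) = s.1 - 1 + A.length := by simp [plugEquiv, h]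
    simp only [hv]
    simp only [plug, List.get_eq_getElem]
    rw [List.getElem_append_right (by simp; omega), List.getElem_drop]
    congr 1
    simp
    omega

/-! ### Objects with underlying standard Borel spaces, and tuples of values -/

/-- A collection of objects, each with an underlying standard Borel space. -/
structure BorelObjects where
  /-- the objects -/
  Ob : Type u
  /-- the underlying space of an object -/
  carrier : Ob → Type v
  [measurableSpace : ∀ X, MeasurableSpace (carrier X)]
  [standardBorel : ∀ X, StandardBorelSpace (carrier X)]

attribute [instance] BorelObjects.measurableSpace BorelObjects.standardBorel

namespace BorelObjects

variable (S : BorelObjects.{u, v})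

/-- The underlying space of an ordered profile, with the product σ-algebra. -/
abbrev Tuple (A : List S.Ob) : Type v := ∀ r : Fin A.length, S.carrier (A.get r)

/-- Tuples of values at all slots of `C` other than `j`. -/
abbrev Punctured (C : List S.Ob) (j : Fin C.length) : Type v :=
  ∀ s : {s : Fin C.length // s ≠ j}, S.carrier (C.get s.1)

/-- The identification of underlying spaces along an equality of objects. -/
def castOb {X Y : S.Ob} (h : X = Y) : S.carrier X → S.carrier Y := cast (congrArg S.carrier h)

theorem measurable_castOb {X Y : S.Ob} (h : X = Y) : Measurable (S.castOb h) := by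
  subst h
  exact measurable_id

@[simp] theorem castOb_rfl {X : S.Ob} (h : X = X) (x : S.carrier X) : S.castOb h x = x := rfl

/-- A value, as a tuple of length one. -/
def single {X : S.Ob} (x : S.carrier X) : S.Tuple [X] :=
  fun r => S.castOb (by simp) x

theorem measurable_single {X : S.Ob} : Measurable (S.single (X := X)) :=
  measurable_pi_lambda _ fun _ => S.measurable_castOb _

/-- The value held by a tuple of length one. -/
def unsingle {X : S.Ob} (z : S.Tuple [X]) : S.carrier X := z (0 : Fin 1)

theorem measurable_unsingle {X : S.Ob} : Measurable (S.unsingle (X := X)) :=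
  measurable_pi_apply (0 : Fin 1)

variable {S}

/-- `inner` reads off `𝐚` from the value `V_j(𝐚, 𝐜_{-j})`. -/
def inner {C : List S.Ob} {j : Fin C.length} {A : List S.Ob} (g : S.Tuple (plug C j A)) :
    S.Tuple A :=
  fun s => S.castOb (plug_get_inl C j A s) (g (plugEquiv C j A (Sum.inl s)))

/-- `outer` reads off `𝐜_{-j}` from the value `V_j(𝐚, 𝐜_{-j})`. -/
def outer {C : List S.Ob} {j : Fin C.length} {A : List S.Ob} (g : S.Tuple (plug C j A)) :
    S.Punctured C j :=
  fun s => S.castOb (plug_get_inr C j A s) (g (plugEquiv C j A (Sum.inr s)))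

/-- The projection `π_{-i}` forgetting the `i`-th coordinate. -/
def omit1 {B : List S.Ob} (i : Fin B.length) (b : S.Tuple B) : S.Punctured B i :=
  fun s => b s.1

/-- `T_j(𝐜_{-j}, z)`: insert the value `z` at the slot `j`. -/
def insertAt {C : List S.Ob} {j : Fin C.length} (c : S.Punctured C j)
    (z : S.carrier (C.get j)) : S.Tuple C :=
  fun s => if h : s = j then S.castOb (by rw [h]) z else c ⟨s, h⟩

/-- The tuple of profile `plug B i D` made of `𝐝` in place of the slot `i` and of the values `c` at
the other slots of `B`; this is `U_i(c, 𝐝)` on outputs and `V_i(𝐝, c)` on inputs. -/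
def plugIn {B : List S.Ob} {i : Fin B.length} {D : List S.Ob} (c : S.Punctured B i)
    (d : S.Tuple D) : S.Tuple (plug B i D) :=
  fun r => match h : (plugEquiv B i D).symm r with
    | Sum.inl s => S.castOb (by
        rw [← plug_get_inl B i D s, ← h, Equiv.apply_symm_apply]) (d s)
    | Sum.inr s => S.castOb (by
        rw [← plug_get_inr B i D s, ← h, Equiv.apply_symm_apply]) (c s)

theorem measurable_inner {C : List S.Ob} {j : Fin C.length} {A : List S.Ob} :
    Measurable (inner : S.Tuple (plug C j A) → S.Tuple A) :=
  measurable_pi_lambda _ fun _ => (S.measurable_castOb _).comp (measurable_pi_apply _)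

theorem measurable_outer {C : List S.Ob} {j : Fin C.length} {A : List S.Ob} :
    Measurable (outer : S.Tuple (plug C j A) → S.Punctured C j) :=
  measurable_pi_lambda _ fun _ => (S.measurable_castOb _).comp (measurable_pi_apply _)

theorem measurable_omit1 {B : List S.Ob} (i : Fin B.length) :
    Measurable (omit1 i : S.Tuple B → S.Punctured B i) :=
  measurable_pi_lambda _ fun _ => measurable_pi_apply _

theorem measurable_insertAt {C : List S.Ob} {j : Fin C.length} :
    Measurable fun p : S.Punctured C j × S.carrier (C.get j) => insertAt p.1 p.2 := by
  refine measurable_pi_lambda _ fun s => ?_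
  by_cases h : s = j
  · simp only [insertAt, h, dite_true]
    exact (S.measurable_castOb _).comp measurable_snd
  · simp only [insertAt, h, dite_false]
    exact (measurable_pi_apply _).comp measurable_fst

theorem measurable_plugIn {B : List S.Ob} {i : Fin B.length} {D : List S.Ob} :
    Measurable fun p : S.Punctured B i × S.Tuple D => plugIn p.1 p.2 := by
  refine measurable_pi_lambda _ fun r => ?_
  unfold plugIn
  split
  · exact (S.measurable_castOb _).comp ((measurable_pi_apply _).comp measurable_snd)
  · exact (S.measurable_castOb _).comp ((measurable_pi_apply _).comp measurable_fst)

theorem inner_plugIn {B : List S.Ob} {i : Fin B.length} {D : List S.Ob} (c : S.Punctured B i)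
    (d : S.Tuple D) : inner (plugIn c d) = d := by
  funext s
  unfold inner plugIn
  split
  · next t h =>
    rw [Equiv.symm_apply_apply] at h
    obtain rfl := Sum.inl.inj h
    simp [castOb]
  · next t h =>
    rw [Equiv.symm_apply_apply] at h
    cases h

theorem outer_plugIn {B : List S.Ob} {i : Fin B.length} {D : List S.Ob} (c : S.Punctured B i)
    (d : S.Tuple D) : outer (plugIn c d) = c := by
  funext s
  unfold outer plugIn
  split
  · next t h =>
    rw [Equiv.symm_apply_apply] at h
    cases h
  · next t h =>
    rw [Equiv.symm_apply_apply] at h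
    obtain rfl := Sum.inr.inj h
    simp [castOb]

/-! ### Kernel slotwise composition -/

/-- Kernel slotwise composition `l ∘_{(i,j)} k`: the `i`-th output of `k` is fed to the `j`-th
input of `l` and integrated out. -/
noncomputable def ksc {A B C D : List S.Ob} (k : Kernel (S.Tuple A) (S.Tuple B))
    (i : Fin B.length) (l : Kernel (S.Tuple C) (S.Tuple D)) (j : Fin C.length)
    (h : B.get i = C.get j) : Kernel (S.Tuple (plug C j A)) (S.Tuple (plug B i D)) :=
  ((k.comap inner measurable_inner) ⊗ₖ
    (l.comap (fun p : S.Tuple (plug C j A) × S.Tuple B =>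
        insertAt (outer p.1) (S.castOb h (p.2 i)))
      (measurable_insertAt.comp ((measurable_outer.comp measurable_fst).prodMk
        ((S.measurable_castOb h).comp ((measurable_pi_apply i).comp measurable_snd)))))).map
    fun p => plugIn (omit1 i p.1) p.2

/-- The colored integral formula: the `i`-th output of `k`, an object `X`, is passed through the
unary kernel `κ : (X) → (Y)`, and the result is fed to the `j`-th input of `l`, an object `Y`;
the connected values are integrated out. -/
noncomputable def kscVia {A B C D : List S.Ob} {X Y : S.Ob}
    (k : Kernel (S.Tuple A) (S.Tuple B)) (i : Fin B.length) (hX : B.get i = X)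
    (κ : Kernel (S.Tuple [X]) (S.Tuple [Y]))
    (l : Kernel (S.Tuple C) (S.Tuple D)) (j : Fin C.length) (hY : C.get j = Y) :
    Kernel (S.Tuple (plug C j A)) (S.Tuple (plug B i D)) :=
  (((k.comap inner measurable_inner) ⊗ₖ
    (κ.comap (fun p : S.Tuple (plug C j A) × S.Tuple B => S.single (S.castOb hX (p.2 i)))
      (S.measurable_single.comp ((S.measurable_castOb hX).comp
        ((measurable_pi_apply i).comp measurable_snd))))) ⊗ₖ
    (l.comap (fun p : S.Tuple (plug C j A) × (S.Tuple B × S.Tuple [Y]) =>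
        insertAt (outer p.1) (S.castOb hY.symm (S.unsingle p.2.2)))
      (measurable_insertAt.comp ((measurable_outer.comp measurable_fst).prodMk
        ((S.measurable_castOb hY.symm).comp (S.measurable_unsingle.comp
          (measurable_snd.comp measurable_snd))))))).map
    fun p => plugIn (omit1 i p.1.1) p.2

instance isMarkov_ksc {A B C D : List S.Ob} (k : Kernel (S.Tuple A) (S.Tuple B)) [IsMarkovKernel k]
    (i : Fin B.length) (l : Kernel (S.Tuple C) (S.Tuple D)) [IsMarkovKernel l] (j : Fin C.length)
    (h : B.get i = C.get j) : IsMarkovKernel (ksc k i l j h) :=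
  Kernel.IsMarkovKernel.map _ (measurable_plugIn.comp
    (((measurable_omit1 i).comp measurable_fst).prodMk measurable_snd))

theorem ksc_apply {A B C D : List S.Ob} (k : Kernel (S.Tuple A) (S.Tuple B)) [IsMarkovKernel k]
    (i : Fin B.length) (l : Kernel (S.Tuple C) (S.Tuple D)) [IsMarkovKernel l] (j : Fin C.length)
    (h : B.get i = C.get j) {E : Set (S.Tuple (plug B i D))} (hE : MeasurableSet E)
    (a : S.Tuple A) (c : S.Punctured C j) :
    ksc k i l j h (plugIn c a) E =
      ∫⁻ b, ∫⁻ d, E.indicator 1 (plugIn (omit1 i b) d) ∂(l (insertAt c (S.castOb h (b i))))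
        ∂(k a) := by
  have hm : Measurable fun p : S.Tuple B × S.Tuple D => plugIn (omit1 i p.1) p.2 :=
    measurable_plugIn.comp (((measurable_omit1 i).comp measurable_fst).prodMk measurable_snd)
  have h1 : Measurable (E.indicator (1 : S.Tuple (plug B i D) → ENNReal)) :=
    measurable_one.indicator hE
  rw [ksc, ← lintegral_indicator_one hE, Kernel.map_apply _ hm, lintegral_map h1 hm]
  refine (Kernel.lintegral_compProd _ _ _ (h1.comp hm)).trans ?_
  simp only [Function.comp_def, Kernel.comap_apply, inner_plugIn, outer_plugIn]

instance isMarkov_kscVia {A B C D : List S.Ob} {X Y : S.Ob}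
    (k : Kernel (S.Tuple A) (S.Tuple B)) [IsMarkovKernel k] (i : Fin B.length)
    (hX : B.get i = X) (κ : Kernel (S.Tuple [X]) (S.Tuple [Y])) [IsMarkovKernel κ]
    (l : Kernel (S.Tuple C) (S.Tuple D)) [IsMarkovKernel l] (j : Fin C.length)
    (hY : C.get j = Y) : IsMarkovKernel (kscVia k i hX κ l j hY) :=
  Kernel.IsMarkovKernel.map _ (measurable_plugIn.comp (((measurable_omit1 i).comp
    (measurable_fst.comp measurable_fst)).prodMk measurable_snd))

theorem kscVia_apply {A B C D : List S.Ob} {X Y : S.Ob}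
    (k : Kernel (S.Tuple A) (S.Tuple B)) [IsMarkovKernel k] (i : Fin B.length)
    (hX : B.get i = X) (κ : Kernel (S.Tuple [X]) (S.Tuple [Y])) [IsMarkovKernel κ]
    (l : Kernel (S.Tuple C) (S.Tuple D)) [IsMarkovKernel l] (j : Fin C.length)
    (hY : C.get j = Y) {E : Set (S.Tuple (plug B i D))} (hE : MeasurableSet E)
    (a : S.Tuple A) (c : S.Punctured C j) :
    kscVia k i hX κ l j hY (plugIn c a) E =
      ∫⁻ b, ∫⁻ z, ∫⁻ d, E.indicator 1 (plugIn (omit1 i b) d)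
        ∂(l (insertAt c (S.castOb hY.symm (S.unsingle z)))) ∂(κ (S.single (S.castOb hX (b i)))) ∂(k a) := by
  have hm : Measurable fun p : (S.Tuple B × S.Tuple [Y]) × S.Tuple D =>
      plugIn (omit1 i p.1.1) p.2 :=
    measurable_plugIn.comp (((measurable_omit1 i).comp
      (measurable_fst.comp measurable_fst)).prodMk measurable_snd)
  have h1 : Measurable (E.indicator (1 : S.Tuple (plug B i D) → ENNReal)) :=
    measurable_one.indicator hE
  rw [kscVia, ← lintegral_indicator_one hE, Kernel.map_apply _ hm, lintegral_map h1 hm]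
  refine (Kernel.lintegral_compProd _ _ _ (h1.comp hm)).trans ?_
  refine (Kernel.lintegral_compProd _ _ _ ?_).trans ?_
  · exact Measurable.lintegral_kernel_prod_right'' (h1.comp hm)
  · simp only [Function.comp_def, Kernel.comap_apply, inner_plugIn, outer_plugIn]

end BorelObjects

/-! ### Markov polycategories -/

/-- A Markov polycategory: objects with underlying standard Borel spaces, and morphisms between
ordered profiles which are Markov kernels, containing the identity kernels and closed under kernel
slotwise composition. -/
structure MarkovPolycategory extends BorelObjects.{u, v} where
  /-- the morphisms between two profiles -/
  Hom : ∀ A B : List Ob, Set (Kernel (toBorelObjects.Tuple A) (toBorelObjects.Tuple B))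
  isMarkov : ∀ {A B : List Ob} {k}, k ∈ Hom A B → IsMarkovKernel k
  id_mem : ∀ X : Ob, Kernel.id ∈ Hom [X] [X]
  ksc_mem : ∀ {A B C D : List Ob} {k l}, k ∈ Hom A B → l ∈ Hom C D →
    ∀ (i : Fin B.length) (j : Fin C.length) (h : B.get i = C.get j),
      BorelObjects.ksc k i l j h ∈ Hom (plug C j A) (plug B i D)

/-- An ordered polycategory with a given collection of objects. The composite
`comp k i l j h` is `l ∘_{(i,j)} k`. Equations are between morphisms whose profiles are equal as
ordered tuples; the interchange laws are required when the two iterated composites have the same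
ordered external slots. -/
structure OrderedPolycategory (Ob : Type u) where
  /-- the morphisms between two profiles -/
  Hom : List Ob → List Ob → Type v
  /-- the identity morphisms -/
  id : ∀ X : Ob, Hom [X] [X]
  /-- slotwise composition -/
  comp : ∀ {A B C D : List Ob} (_ : Hom A B) (i : Fin B.length) (_ : Hom C D) (j : Fin C.length),
    B.get i = C.get j → Hom (plug C j A) (plug B i D)
  id_comp : ∀ {A B : List Ob} (k : Hom A B) (j : Fin A.length),
    HEq (comp (id (A.get j)) (0 : Fin 1) k j rfl) k
  comp_id : ∀ {A B : List Ob} (k : Hom A B) (i : Fin B.length),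
    HEq (comp k i (id (B.get i)) (0 : Fin 1) rfl) k
  assoc : ∀ {A B C D E F : List Ob} (k : Hom A B) (i : Fin B.length) (l : Hom C D)
    (j : Fin C.length) (h : B.get i = C.get j) (i' : Fin D.length) (m : Hom E F)
    (j' : Fin E.length) (h' : D.get i' = E.get j'),
    HEq
      (comp (comp k i l j h) (plugEquiv B i D (Sum.inl i')) m j' ((plug_get_inl B i D i').trans h'))
      (comp k i (comp l i' m j' h') (plugEquiv E j' C (Sum.inl j))
        (h.trans (plug_get_inl E j' C j).symm))
  interchange_out : ∀ {A B C₁ D₁ C₂ D₂ : List Ob} (k : Hom A B) (i₁ i₂ : Fin B.length)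
    (h₂₁ : i₂ ≠ i₁) (l₁ : Hom C₁ D₁) (j₁ : Fin C₁.length) (h₁ : B.get i₁ = C₁.get j₁)
    (l₂ : Hom C₂ D₂) (j₂ : Fin C₂.length) (h₂ : B.get i₂ = C₂.get j₂),
    ((j₁ : ℕ) = 0 ∨ (j₂ : ℕ) = 0) →
    ((j₁ : ℕ) + 1 = C₁.length ∨ (j₂ : ℕ) + 1 = C₂.length) →
    HEq
      (comp (comp k i₁ l₁ j₁ h₁) (plugEquiv B i₁ D₁ (Sum.inr ⟨i₂, h₂₁⟩)) l₂ j₂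
        ((plug_get_inr B i₁ D₁ ⟨i₂, h₂₁⟩).trans h₂))
      (comp (comp k i₂ l₂ j₂ h₂) (plugEquiv B i₂ D₂ (Sum.inr ⟨i₁, h₂₁.symm⟩)) l₁ j₁
        ((plug_get_inr B i₂ D₂ ⟨i₁, h₂₁.symm⟩).trans h₁))
  interchange_in : ∀ {A₁ B₁ A₂ B₂ C D : List Ob} (l : Hom C D) (j₁ j₂ : Fin C.length)
    (h₂₁ : j₂ ≠ j₁) (k₁ : Hom A₁ B₁) (i₁ : Fin B₁.length) (h₁ : B₁.get i₁ = C.get j₁)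
    (k₂ : Hom A₂ B₂) (i₂ : Fin B₂.length) (h₂ : B₂.get i₂ = C.get j₂),
    ((i₁ : ℕ) = 0 ∨ (i₂ : ℕ) = 0) →
    ((i₁ : ℕ) + 1 = B₁.length ∨ (i₂ : ℕ) + 1 = B₂.length) →
    HEq
      (comp k₂ i₂ (comp k₁ i₁ l j₁ h₁) (plugEquiv C j₁ A₁ (Sum.inr ⟨j₂, h₂₁⟩))
        (h₂.trans (plug_get_inr C j₁ A₁ ⟨j₂, h₂₁⟩).symm))
      (comp k₁ i₁ (comp k₂ i₂ l j₂ h₂) (plugEquiv C j₂ A₂ (Sum.inr ⟨j₁, h₂₁.symm⟩))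
        (h₁.trans (plug_get_inr C j₂ A₂ ⟨j₁, h₂₁.symm⟩).symm))

/-- A color system: a category `K` of object colors, an ordered polycategory `M` of morphism colors
between tuples of object colors, and a functorial map `ι` turning a morphism of object colors into a
unary morphism color. -/
structure ColorSystem where
  /-- the object colors -/
  K : Type uK
  [category : Category.{vK} K]
  /-- the morphism colors -/
  M : OrderedPolycategory.{uK, wM} K
  /-- the morphism color of an interface -/
  ι : ∀ {c d : K}, (c ⟶ d) → M.Hom [c] [d]
  ι_id : ∀ c : K, ι (𝟙 c) = M.id c
  ι_comp : ∀ {c d e : K} (f : c ⟶ d) (g : d ⟶ e),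
    ι (f ≫ g) = M.comp (ι f) (0 : Fin 1) (ι g) (0 : Fin 1) rfl

attribute [instance] ColorSystem.category

/-- A colored Markov polycategory over a color system: a Markov polycategory with object colors `χ`,
morphism colors `ψ` compatible with identities and slotwise composition, and an interface system,
i.e. sets `Int B C` of admissible interface witnesses `f : χ B ⟶ χ C` and interface kernels
`κ f : (B) → (C)` of color `ι f`, compatible with identities and composition. -/
structure CMP (𝒞 : ColorSystem.{uK, vK, wM}) extends MarkovPolycategory.{u, v} where
  /-- object colors -/
  χ : Ob → 𝒞.K
  /-- morphism colors -/
  ψ : ∀ {A B : List Ob}, Hom A B → 𝒞.M.Hom (A.map χ) (B.map χ)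
  ψ_id : ∀ X : Ob, ψ ⟨Kernel.id, id_mem X⟩ = 𝒞.M.id (χ X)
  ψ_ksc : ∀ {A B C D : List Ob} (k : Hom A B) (l : Hom C D) (i : Fin B.length)
    (j : Fin C.length) (h : B.get i = C.get j),
    HEq (ψ ⟨BorelObjects.ksc k.1 i l.1 j h, ksc_mem k.2 l.2 i j h⟩)
      (𝒞.M.comp (ψ k) (i.cast (List.length_map χ).symm) (ψ l) (j.cast (List.length_map χ).symm)
        (by simpa using congrArg χ h))
  /-- admissible interface witnesses -/
  Int : ∀ B C : Ob, Set (χ B ⟶ χ C)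
  /-- interface kernels -/
  κ : ∀ {B C : Ob} (f : χ B ⟶ χ C), f ∈ Int B C →
    Kernel (toBorelObjects.Tuple [B]) (toBorelObjects.Tuple [C])
  κ_mem : ∀ {B C : Ob} (f : χ B ⟶ χ C) (hf : f ∈ Int B C), κ f hf ∈ Hom [B] [C]
  ψ_κ : ∀ {B C : Ob} (f : χ B ⟶ χ C) (hf : f ∈ Int B C), ψ ⟨κ f hf, κ_mem f hf⟩ = 𝒞.ι f
  id_mem_Int : ∀ B : Ob, 𝟙 (χ B) ∈ Int B B
  κ_id : ∀ B : Ob, κ (𝟙 (χ B)) (id_mem_Int B) = Kernel.id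
  comp_mem_Int : ∀ {B C D : Ob} {f : χ B ⟶ χ C} {g : χ C ⟶ χ D},
    f ∈ Int B C → g ∈ Int C D → f ≫ g ∈ Int B D
  κ_comp : ∀ {B C D : Ob} {f : χ B ⟶ χ C} {g : χ C ⟶ χ D} (hf : f ∈ Int B C)
    (hg : g ∈ Int C D), κ (f ≫ g) (comp_mem_Int hf hg) = κ g hg ∘ₖ κ f hf

/-- The colored kernel slotwise composite `l ∘^f_{(i,j)} k` of two kernels between profiles of
objects, through the interface kernel `κ_{f;B,C}`, where `B` is the `i`-th output object of `k` and
`C` is the `j`-th input object of `l`. -/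
noncomputable def CMP.cksc {𝒞 : ColorSystem.{uK, vK, wM}} (P : CMP.{u, v} 𝒞)
    {A' B' C' D' : List P.Ob} {B C : P.Ob}
    (k : Kernel (P.Tuple A') (P.Tuple B')) (i : Fin B'.length) (hB : B'.get i = B)
    (f : P.χ B ⟶ P.χ C) (hf : f ∈ P.Int B C)
    (l : Kernel (P.Tuple C') (P.Tuple D')) (j : Fin C'.length) (hC : C'.get j = C) :
    Kernel (P.Tuple (plug C' j A')) (P.Tuple (plug B' i D')) :=
  BorelObjects.kscVia k i hB (P.κ f hf) l j hC

/-! ### Finite acyclic wirings -/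

/-- A finite acyclic wiring: finitely many vertices with ordered input and output profiles, finitely
many internal wires from output slots to input slots, and ordered lists of external slots. By
`in_bij` every input slot is either the target of exactly one internal wire, or external and listed
exactly once; similarly for output slots. -/
structure Wiring (Ob : Type u) where
  /-- vertices -/
  V : Type w
  /-- internal wires -/
  W : Type w
  [finiteV : Finite V]
  [finiteW : Finite W]
  /-- input profile of a vertex -/
  inp : V → List Ob
  /-- output profile of a vertex -/
  out : V → List Ob
  /-- the output slot from which a wire starts -/
  src : W → Σ u : V, Fin (out u).length
  /-- the input slot at which a wire ends -/
  tgt : W → Σ v : V, Fin (inp v).length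
  acyclic : ∀ u : V, ¬ Relation.TransGen (fun a b => ∃ e, (src e).1 = a ∧ (tgt e).1 = b) u u
  /-- external input profile -/
  I : List Ob
  /-- external output profile -/
  O : List Ob
  /-- ordered list of the external input slots -/
  extIn : Fin I.length → Σ v : V, Fin (inp v).length
  /-- ordered list of the external output slots -/
  extOut : Fin O.length → Σ u : V, Fin (out u).length
  extIn_obj : ∀ s, (inp (extIn s).1).get (extIn s).2 = I.get s
  extOut_obj : ∀ s, (out (extOut s).1).get (extOut s).2 = O.get s
  in_bij : Function.Bijective (Sum.elim tgt extIn)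
  out_bij : Function.Bijective (Sum.elim src extOut)

attribute [instance] Wiring.finiteV Wiring.finiteW

namespace Wiring

variable {Ob : Type u} (G : Wiring.{u, w} Ob)

/-- A topological ordering: an enumeration of the vertices along which wires go forward. -/
structure TopOrder where
  /-- the number of vertices -/
  n : ℕ
  /-- the position of a vertex -/
  pos : G.V ≃ Fin n
  lt : ∀ e, pos (G.src e).1 < pos (G.tgt e).1

/-- Every finite acyclic wiring has a topological ordering. -/
theorem nonempty_topOrder : Nonempty G.TopOrder := by
  classical
  let R : G.V → G.V → Prop := fun a b => ∃ e, (G.src e).1 = a ∧ (G.tgt e).1 = b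
  let P : PartialOrder G.V :=
    { le := Relation.ReflTransGen R
      le_refl := fun _ => Relation.ReflTransGen.refl
      le_trans := fun _ _ _ => Relation.ReflTransGen.trans
      le_antisymm := fun a b hab hba => by
        rcases Relation.reflTransGen_iff_eq_or_transGen.1 hab with h | h
        · exact h.symm
        · exact absurd (h.trans_left hba) (G.acyclic a) }
  have : Finite (@LinearExtension G.V) := G.finiteV
  let _ : Fintype (@LinearExtension G.V) := Fintype.ofFinite _
  let φ := Fintype.orderIsoFinOfCardEq (@LinearExtension G.V) rfl
  refine ⟨⟨_, φ.symm.toEquiv, fun e => ?_⟩⟩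
  have hle : @LE.le G.V P.toLE (G.src e).1 (G.tgt e).1 := Relation.ReflTransGen.single ⟨e, rfl, rfl⟩
  have hne : (G.src e).1 ≠ (G.tgt e).1 := fun h => by
    apply G.acyclic (G.src e).1
    exact Relation.TransGen.single ⟨e, rfl, h.symm⟩
  have h1 : (toLinearExtension (G.src e).1) ≤ (toLinearExtension (G.tgt e).1) :=
    toLinearExtension.monotone' hle
  exact φ.symm.strictMono (lt_of_le_of_ne h1 hne)

/-- What is attached to an input slot: an internal wire or an external input. -/
noncomputable def inEquiv : G.W ⊕ Fin G.I.length ≃ Σ v : G.V, Fin (G.inp v).length :=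
  Equiv.ofBijective _ G.in_bij

theorem inEquiv_inl (e : G.W) : G.inEquiv (Sum.inl e) = G.tgt e := rfl

theorem inEquiv_inr (s : Fin G.I.length) : G.inEquiv (Sum.inr s) = G.extIn s := rfl

/-- The object at an input slot. -/
def inOb (q : Σ v : G.V, Fin (G.inp v).length) : Ob := (G.inp q.1).get q.2

/-- The object at an output slot. -/
def outOb (p : Σ u : G.V, Fin (G.out u).length) : Ob := (G.out p.1).get p.2

end Wiring

/-! ### KSC diagrams and their trace kernels -/

/-- A finite acyclic KSC diagram in a Markov polycategory: a finite acyclic wiring whose vertices are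
labelled by morphisms, and whose wires connect slots carrying the same object. -/
structure KSCDiagram (P : MarkovPolycategory.{u, v}) extends Wiring.{u, w} P.Ob where
  /-- the kernel labelling a vertex -/
  ker : ∀ x : V, Kernel (P.Tuple (inp x)) (P.Tuple (out x))
  ker_mem : ∀ x, ker x ∈ P.Hom (inp x) (out x)
  wire_obj : ∀ e, (out (src e).1).get (src e).2 = (inp (tgt e).1).get (tgt e).2

namespace KSCDiagram

variable {P : MarkovPolycategory.{u, v}} (D : KSCDiagram.{u, v, w} P) (σ : D.TopOrder)

instance (x : D.V) : IsMarkovKernel (D.ker x) := P.isMarkov (D.ker_mem x)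

/-- Outputs of the vertices at the first `r` positions of a topological ordering. -/
abbrev Prefix (r : ℕ) : Type (max v w) := ∀ x : {x : D.V // (σ.pos x : ℕ) < r}, P.Tuple (D.out x)

/-- The value supplied by `s` to the input slot `q` of the vertex at position `r`, given the external
input values and the outputs of all the earlier vertices: an external input value if `s` is an
external input, the value of the output slot from which `s` starts if `s` is a wire. -/
def suppliedValue (r : Fin σ.n) (q : Fin (D.inp (σ.pos.symm r)).length) :
    ∀ s : D.W ⊕ Fin D.I.length, D.inEquiv s = ⟨σ.pos.symm r, q⟩ →
      P.Tuple D.I × D.Prefix σ r → P.carrier ((D.inp (σ.pos.symm r)).get q)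
  | Sum.inl e, ht => fun p =>
      P.castOb ((D.wire_obj e).trans (congrArg D.inOb ht))
        (p.2 ⟨(D.src e).1, by
          have h1 := σ.lt e
          rw [← D.inEquiv_inl, congrArg Sigma.fst ht, Equiv.apply_symm_apply] at h1
          exact h1⟩ (D.src e).2)
  | Sum.inr s, ht => fun p =>
      P.castOb ((D.extIn_obj s).symm.trans (congrArg D.inOb ht)) (p.1 s)

theorem measurable_suppliedValue (r : Fin σ.n) (q : Fin (D.inp (σ.pos.symm r)).length) :
    ∀ (s : D.W ⊕ Fin D.I.length) (h : D.inEquiv s = ⟨σ.pos.symm r, q⟩),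
      Measurable (D.suppliedValue σ r q s h)
  | Sum.inl _, _ => (P.measurable_castOb _).comp
      ((measurable_pi_apply _).comp ((measurable_pi_apply _).comp measurable_snd))
  | Sum.inr _, _ => (P.measurable_castOb _).comp ((measurable_pi_apply _).comp measurable_fst)

/-- The input tuple of the vertex at position `r`. -/
noncomputable def inputTuple (r : Fin σ.n) (p : P.Tuple D.I × D.Prefix σ r) :
    P.Tuple (D.inp (σ.pos.symm r)) :=
  fun q => D.suppliedValue σ r q (D.inEquiv.symm ⟨σ.pos.symm r, q⟩)
    (D.inEquiv.apply_symm_apply _) p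

theorem measurable_inputTuple (r : Fin σ.n) : Measurable (D.inputTuple σ r) :=
  measurable_pi_lambda _ fun q => D.measurable_suppliedValue σ r q _ _

/-- Append the output of the vertex at position `r` to the outputs of the earlier vertices. -/
def extend (r : Fin σ.n) (p : D.Prefix σ r × P.Tuple (D.out (σ.pos.symm r))) :
    D.Prefix σ (r + 1) :=
  fun x => if h : (σ.pos x.1 : ℕ) < r then p.1 ⟨x.1, h⟩ else
    cast (congrArg (fun y => P.Tuple (D.out y)) (by
      rw [Equiv.symm_apply_eq]
      apply Fin.ext
      have := x.2
      omega)) p.2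

theorem measurable_extend (r : Fin σ.n) : Measurable (D.extend σ r) := by
  refine measurable_pi_lambda _ fun x => ?_
  by_cases h : (σ.pos x.1 : ℕ) < r
  · simp only [extend, h, dite_true]
    exact (measurable_pi_apply _).comp measurable_fst
  · have hx : σ.pos.symm r = x.1 := by
      rw [Equiv.symm_apply_eq]
      apply Fin.ext
      have := x.2
      omega
    have hc : ∀ (y : D.V) (hy : σ.pos.symm r = y),
        Measurable (cast (congrArg (fun y => P.Tuple (D.out y)) hy)) := by
      rintro _ rfl
      exact measurable_id
    simp only [extend, h, dite_false]
    exact (hc _ hx).comp measurable_snd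

/-- The trace measure of the first `r` vertices, conditional on the external input: sample the
vertices in the given order, each from its kernel evaluated at its input tuple. -/
noncomputable def traceMeasure : ∀ r : ℕ, r ≤ σ.n → Kernel (P.Tuple D.I) (D.Prefix σ r)
  | 0, _ => Kernel.const _ (Measure.dirac fun x => absurd x.2 (Nat.not_lt_zero _))
  | r + 1, h =>
      ((traceMeasure r (Nat.le_of_succ_le h)) ⊗ₖ
        ((D.ker (σ.pos.symm ⟨r, h⟩)).comap (D.inputTuple σ ⟨r, h⟩)
          (D.measurable_inputTuple σ ⟨r, h⟩))).map (D.extend σ ⟨r, h⟩)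

/-- The external output projection. -/
def outputTuple (y : D.Prefix σ σ.n) : P.Tuple D.O :=
  fun s => P.castOb (D.extOut_obj s) (y ⟨(D.extOut s).1, (σ.pos _).isLt⟩ (D.extOut s).2)

theorem measurable_outputTuple : Measurable (D.outputTuple σ) :=
  measurable_pi_lambda _ fun _ => (P.measurable_castOb _).comp
    ((measurable_pi_apply _).comp (measurable_pi_apply _))

/-- The trace kernel evaluated along a topological ordering. -/
noncomputable def traceKernelAlong : Kernel (P.Tuple D.I) (P.Tuple D.O) :=
  (D.traceMeasure σ σ.n le_rfl).map (D.outputTuple σ)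

instance isMarkov_traceMeasure : ∀ (r : ℕ) (h : r ≤ σ.n), IsMarkovKernel (D.traceMeasure σ r h)
  | 0, _ => by
    unfold traceMeasure
    infer_instance
  | r + 1, h => by
    have := isMarkov_traceMeasure r (Nat.le_of_succ_le h)
    unfold traceMeasure
    exact Kernel.IsMarkovKernel.map _ (D.measurable_extend σ ⟨r, h⟩)

instance isMarkov_traceKernelAlong : IsMarkovKernel (D.traceKernelAlong σ) :=
  Kernel.IsMarkovKernel.map _ (D.measurable_outputTuple σ)

/-- The trace kernel of a finite acyclic KSC diagram, evaluated along a chosen topological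
ordering. -/
noncomputable def traceKernel : Kernel (P.Tuple D.I) (P.Tuple D.O) :=
  D.traceKernelAlong D.nonempty_topOrder.some

instance isMarkov_traceKernel : IsMarkovKernel D.traceKernel :=
  D.isMarkov_traceKernelAlong _

end KSCDiagram

/-! ### CKSC diagrams, interface expansion and trace kernels -/

section Slots

variable {α : Type u} {X Y : Type w}

/-- Slots of a family of profiles. -/
abbrev Slot (f : X → List α) : Type w := Σ x : X, Fin (f x).length

/-- Slots of the left summand of a family of profiles over `X ⊕ Y`. -/
def slotInl (f : X → List α) (g : Y → List α) (p : Slot f) : Slot (Sum.elim f g) :=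
  ⟨Sum.inl p.1, p.2⟩

/-- Slots of the right summand of a family of profiles over `X ⊕ Y`. -/
def slotInr (f : X → List α) (g : Y → List α) (p : Slot g) : Slot (Sum.elim f g) :=
  ⟨Sum.inr p.1, p.2⟩

theorem slotInl_injective (f : X → List α) (g : Y → List α) :
    Function.Injective (slotInl f g) := by
  rintro ⟨x, a⟩ ⟨y, b⟩ h
  cases h
  rfl

theorem slotInr_injective (f : X → List α) (g : Y → List α) :
    Function.Injective (slotInr f g) := by
  rintro ⟨x, a⟩ ⟨y, b⟩ h
  cases h
  rfl

theorem slotInl_ne_slotInr (f : X → List α) (g : Y → List α) (p : Slot f) (q : Slot g) :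
    slotInl f g p ≠ slotInr f g q := fun h => by
  have := congrArg Sigma.fst h
  simp [slotInl, slotInr] at this

/-- A relation that increases a rank has no cycles. -/
theorem acyclic_of_rank {R : X → X → Prop} (rk : X → ℕ) (h : ∀ a b, R a b → rk a < rk b) (a : X) :
    ¬ Relation.TransGen R a a := fun hc => by
  have : ∀ b, Relation.TransGen R a b → rk a < rk b := fun b hb => by
    induction hb with
    | single hr => exact h _ _ hr
    | tail _ hr ih => exact ih.trans (h _ _ hr)
  exact lt_irrefl _ (this a hc)

/-- Slot bookkeeping for a connection: on one side (inputs or outputs), the wired slots together with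
the listed external slots exhaust the slots without repetition. Here the family `g` is the one whose
external slot `j` is used by the new wire. -/
theorem connect_bij {Z T : Type w} {m : List α} {n : List α} (f : X → List α) (g : Y → List α)
    {t₁ : Z → Slot f} {x₁ : Fin m.length → Slot f} {t₂ : T → Slot g} {x₂ : Fin n.length → Slot g}
    (h₁ : Function.Bijective (Sum.elim t₁ x₁)) (h₂ : Function.Bijective (Sum.elim t₂ x₂))
    (j : Fin n.length) {S : Type w} {Q : Type w} (ι₁ : Slot f → S) (ι₂ : Slot g → S)
    (hι₁ : Function.Injective ι₁) (hι₂ : Function.Injective ι₂) (hne : ∀ p q, ι₁ p ≠ ι₂ q)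
    (hs : ∀ s, (∃ p, ι₁ p = s) ∨ ∃ q, ι₂ q = s)
    (t : Q → S) (q₁ : Z → Q) (q₂ : T → Q) (q₀ : Q) (hq : ∀ q, (∃ e, q₁ e = q) ∨ (∃ e, q₂ e = q) ∨ q = q₀)
    (ht₁ : ∀ e, t (q₁ e) = ι₁ (t₁ e)) (ht₂ : ∀ e, t (q₂ e) = ι₂ (t₂ e)) (ht₀ : t q₀ = ι₂ (x₂ j)) :
    Function.Bijective (Sum.elim t fun r : Fin (plug n j m).length =>
      Sum.elim (fun s => ι₁ (x₁ s)) (fun s => ι₂ (x₂ s.1)) ((plugEquiv n j m).symm r)) := by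
  have i₁ := h₁.injective
  have i₂ := h₂.injective
  have a1 : ∀ e e', t₁ e = t₁ e' → e = e' := fun e e' h => Sum.inl.inj (@i₁ (Sum.inl e) (Sum.inl e') h)
  have a2 : ∀ e e', t₂ e = t₂ e' → e = e' := fun e e' h => Sum.inl.inj (@i₂ (Sum.inl e) (Sum.inl e') h)
  have b1 : ∀ e e', x₁ e = x₁ e' → e = e' := fun e e' h => Sum.inr.inj (@i₁ (Sum.inr e) (Sum.inr e') h)
  have b2 : ∀ e e', x₂ e = x₂ e' → e = e' := fun e e' h => Sum.inr.inj (@i₂ (Sum.inr e) (Sum.inr e') h)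
  have c1 : ∀ e e', t₁ e ≠ x₁ e' := fun e e' h => Sum.inl_ne_inr (@i₁ (Sum.inl e) (Sum.inr e') h)
  have c2 : ∀ e e', t₂ e ≠ x₂ e' := fun e e' h => Sum.inl_ne_inr (@i₂ (Sum.inl e) (Sum.inr e') h)
  have hne' : ∀ p q, ι₂ q ≠ ι₁ p := fun p q h => hne p q h.symm
  constructor
  · have key : ∀ (q : Q) (x : Fin m.length ⊕ {s : Fin n.length // s ≠ j}),
        t q ≠ Sum.elim (fun s => ι₁ (x₁ s)) (fun s => ι₂ (x₂ s.1)) x := by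
      rintro q (s | s) h
      · rcases hq q with ⟨e, rfl⟩ | ⟨e, rfl⟩ | rfl
        · exact c1 _ _ (hι₁ ((ht₁ e).symm.trans h))
        · exact hne' _ _ ((ht₂ e).symm.trans h)
        · exact hne' _ _ (ht₀.symm.trans h)
      · rcases hq q with ⟨e, rfl⟩ | ⟨e, rfl⟩ | rfl
        · exact hne _ _ ((ht₁ e).symm.trans h)
        · exact c2 _ _ (hι₂ ((ht₂ e).symm.trans h))
        · exact s.2 (b2 _ _ (hι₂ (ht₀.symm.trans h))).symm
    rintro (q | r) (q' | r') h
    · congr 1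
      change t q = t q' at h
      rcases hq q with ⟨e, rfl⟩ | ⟨e, rfl⟩ | rfl <;> rcases hq q' with ⟨e', rfl⟩ | ⟨e', rfl⟩ | rfl <;>
        simp only [ht₁, ht₂, ht₀] at h
      · rw [a1 _ _ (hι₁ h)]
      · exact absurd h (hne _ _)
      · exact absurd h (hne _ _)
      · exact absurd h (hne' _ _)
      · rw [a2 _ _ (hι₂ h)]
      · exact absurd (hι₂ h) (c2 _ _)
      · exact absurd h (hne' _ _)
      · exact absurd (hι₂ h).symm (c2 _ _)
      · rfl
    · exact absurd h (key _ _)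
    · exact absurd h.symm (key _ _)
    · obtain ⟨x, rfl⟩ := (plugEquiv n j m).surjective r
      obtain ⟨x', rfl⟩ := (plugEquiv n j m).surjective r'
      simp only [Sum.elim_inr, Equiv.symm_apply_apply] at h
      congr 2
      rcases x with s | s <;> rcases x' with s' | s'
      · rw [b1 _ _ (hι₁ h)]
      · exact absurd h (hne _ _)
      · exact absurd h (hne' _ _)
      · rw [Subtype.ext (b2 _ _ (hι₂ h))]
  · intro s
    rcases hs s with ⟨p, rfl⟩ | ⟨p, rfl⟩
    · obtain ⟨e | r, rfl⟩ := h₁.surjective p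
      · exact ⟨Sum.inl (q₁ e), ht₁ e⟩
      · exact ⟨Sum.inr (plugEquiv n j m (Sum.inl r)), by simp⟩
    · obtain ⟨e | r, rfl⟩ := h₂.surjective p
      · exact ⟨Sum.inl (q₂ e), ht₂ e⟩
      · by_cases hr : r = j
        · subst hr
          exact ⟨Sum.inl q₀, ht₀⟩
        · exact ⟨Sum.inr (plugEquiv n j m (Sum.inr ⟨r, hr⟩)), by simp⟩

end Slots

namespace CMP

variable {𝒞 : ColorSystem.{uK, vK, wM}} (P : CMP.{u, v} 𝒞)

/-- A finite acyclic CKSC diagram: a finite acyclic wiring whose vertices are labelled by morphisms,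
and whose internal wires `e`, from an output slot carrying the object `dom e` to an input slot
carrying the object `cod e`, are labelled by admissible interface witnesses. -/
structure Diagram extends Wiring.{u, w} P.Ob where
  /-- the kernel labelling a vertex -/
  ker : ∀ x : V, Kernel (P.Tuple (inp x)) (P.Tuple (out x))
  ker_mem : ∀ x, ker x ∈ P.Hom (inp x) (out x)
  /-- the object at the source of a wire -/
  dom : W → P.Ob
  /-- the object at the target of a wire -/
  cod : W → P.Ob
  src_obj : ∀ e, (out (src e).1).get (src e).2 = dom e
  tgt_obj : ∀ e, (inp (tgt e).1).get (tgt e).2 = cod e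
  /-- the interface witness on a wire -/
  wit : ∀ e, P.χ (dom e) ⟶ P.χ (cod e)
  wit_mem : ∀ e, wit e ∈ P.Int (dom e) (cod e)

namespace Diagram

variable {P}

/-- The interface expansion: every internal wire `e` is replaced by a unary vertex labelled by its
interface kernel, by a wire `inl e` from the source of `e` to this vertex, and by a wire `inr e` from
this vertex to the target of `e`. -/
def expansion (D : Diagram.{u, v, w} P) : KSCDiagram.{u, v, w} P.toMarkovPolycategory where
  V := D.V ⊕ D.W
  W := D.W ⊕ D.W
  inp := Sum.elim D.inp fun e => [D.dom e]
  out := Sum.elim D.out fun e => [D.cod e]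
  src := Sum.elim (fun e => slotInl _ _ (D.src e)) (fun e => slotInr _ _ ⟨e, (0 : Fin 1)⟩)
  tgt := Sum.elim (fun e => slotInr _ _ ⟨e, (0 : Fin 1)⟩) (fun e => slotInl _ _ (D.tgt e))
  acyclic := by
    obtain ⟨σ⟩ := D.nonempty_topOrder
    refine acyclic_of_rank
      (Sum.elim (fun x => 2 * (σ.pos x : ℕ)) fun e => 2 * (σ.pos (D.src e).1 : ℕ) + 1) ?_
    rintro a b ⟨e | e, rfl, rfl⟩
    · simp [slotInl, slotInr]
    · have := σ.lt e
      rw [Fin.lt_def] at this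
      simp only [slotInl, slotInr, Sum.elim_inr, Sum.elim_inl]
      omega
  I := D.I
  O := D.O
  extIn s := slotInl _ _ (D.extIn s)
  extOut s := slotInl _ _ (D.extOut s)
  extIn_obj := D.extIn_obj
  extOut_obj := D.extOut_obj
  in_bij := by
    constructor
    · rintro ((e | e) | s) ((e' | e') | s') h
      · have := slotInr_injective _ _ h
        simp only [Sigma.mk.injEq] at this
        rw [this.1]
      · exact absurd h.symm (slotInl_ne_slotInr _ _ _ _)
      · exact absurd h.symm (slotInl_ne_slotInr _ _ _ _)
      · exact absurd h (slotInl_ne_slotInr _ _ _ _)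
      · have := D.in_bij.injective (a₁ := Sum.inl e) (a₂ := Sum.inl e') (slotInl_injective _ _ h)
        rw [Sum.inl.inj this]
      · have := D.in_bij.injective (a₁ := Sum.inl e) (a₂ := Sum.inr s') (slotInl_injective _ _ h)
        cases this
      · exact absurd h (slotInl_ne_slotInr _ _ _ _)
      · have := D.in_bij.injective (a₁ := Sum.inr s) (a₂ := Sum.inl e') (slotInl_injective _ _ h)
        cases this
      · have := D.in_bij.injective (a₁ := Sum.inr s) (a₂ := Sum.inr s') (slotInl_injective _ _ h)
        rw [Sum.inr.inj this]
    · rintro ⟨x | e, q⟩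
      · obtain ⟨e | s, h⟩ := D.in_bij.surjective ⟨x, q⟩
        · exact ⟨Sum.inl (Sum.inr e), congrArg (slotInl _ _) h⟩
        · exact ⟨Sum.inr s, congrArg (slotInl _ _) h⟩
      · refine ⟨Sum.inl (Sum.inl e), ?_⟩
        obtain rfl : q = (0 : Fin 1) := Subsingleton.elim (α := Fin 1) _ _
        rfl
  out_bij := by
    constructor
    · rintro ((e | e) | s) ((e' | e') | s') h
      · have := D.out_bij.injective (a₁ := Sum.inl e) (a₂ := Sum.inl e') (slotInl_injective _ _ h)
        rw [Sum.inl.inj this]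
      · exact absurd h (slotInl_ne_slotInr _ _ _ _)
      · have := D.out_bij.injective (a₁ := Sum.inl e) (a₂ := Sum.inr s') (slotInl_injective _ _ h)
        cases this
      · exact absurd h.symm (slotInl_ne_slotInr _ _ _ _)
      · have := slotInr_injective _ _ h
        simp only [Sigma.mk.injEq] at this
        rw [this.1]
      · exact absurd h.symm (slotInl_ne_slotInr _ _ _ _)
      · have := D.out_bij.injective (a₁ := Sum.inr s) (a₂ := Sum.inl e') (slotInl_injective _ _ h)
        cases this
      · exact absurd h (slotInl_ne_slotInr _ _ _ _)
      · have := D.out_bij.injective (a₁ := Sum.inr s) (a₂ := Sum.inr s') (slotInl_injective _ _ h)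
        rw [Sum.inr.inj this]
    · rintro ⟨x | e, q⟩
      · obtain ⟨e | s, h⟩ := D.out_bij.surjective ⟨x, q⟩
        · exact ⟨Sum.inl (Sum.inl e), congrArg (slotInl _ _) h⟩
        · exact ⟨Sum.inr s, congrArg (slotInl _ _) h⟩
      · refine ⟨Sum.inl (Sum.inr e), ?_⟩
        obtain rfl : q = (0 : Fin 1) := Subsingleton.elim (α := Fin 1) _ _
        rfl
  ker
    | Sum.inl x => D.ker x
    | Sum.inr e => P.κ (D.wit e) (D.wit_mem e)
  ker_mem
    | Sum.inl x => D.ker_mem x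
    | Sum.inr e => P.κ_mem (D.wit e) (D.wit_mem e)
  wire_obj
    | Sum.inl e => D.src_obj e
    | Sum.inr e => (D.tgt_obj e).symm

/-- The trace kernel `K_D : 𝐈_D → 𝐎_D` of a finite acyclic CKSC diagram. -/
noncomputable def traceKernel (D : Diagram.{u, v, w} P) : Kernel (P.Tuple D.I) (P.Tuple D.O) :=
  D.expansion.traceKernel

instance isMarkov_traceKernel (D : Diagram.{u, v, w} P) : IsMarkovKernel D.traceKernel :=
  D.expansion.isMarkov_traceKernel

/-- The diagram obtained from the disjoint union of `D₁` and `D₂` by adding one wire, with witness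
`f`, from the `i`-th external output slot of `D₁` to the `j`-th external input slot of `D₂`. Its
external input list is that of `D₂` with slot `j` replaced by the list of `D₁`, and its external
output list is that of `D₁` with slot `i` replaced by the list of `D₂`. -/
def connect (D₁ D₂ : Diagram.{u, v, w} P) (i : Fin D₁.O.length) (j : Fin D₂.I.length)
    {B C : P.Ob} (hB : D₁.O.get i = B) (hC : D₂.I.get j = C) (f : P.χ B ⟶ P.χ C)
    (hf : f ∈ P.Int B C) : Diagram.{u, v, w} P where
  V := D₁.V ⊕ D₂.V
  W := (D₁.W ⊕ D₂.W) ⊕ PUnit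
  inp := Sum.elim D₁.inp D₂.inp
  out := Sum.elim D₁.out D₂.out
  src := Sum.elim (Sum.elim (fun e => slotInl _ _ (D₁.src e)) fun e => slotInr _ _ (D₂.src e))
    fun _ => slotInl _ _ (D₁.extOut i)
  tgt := Sum.elim (Sum.elim (fun e => slotInl _ _ (D₁.tgt e)) fun e => slotInr _ _ (D₂.tgt e))
    fun _ => slotInr _ _ (D₂.extIn j)
  acyclic := by
    obtain ⟨σ₁⟩ := D₁.nonempty_topOrder
    obtain ⟨σ₂⟩ := D₂.nonempty_topOrder
    refine acyclic_of_rank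
      (Sum.elim (fun x => (σ₁.pos x : ℕ)) fun x => σ₁.n + (σ₂.pos x : ℕ)) ?_
    rintro a b ⟨(e | e) | e, rfl, rfl⟩
    · exact σ₁.lt e
    · exact Nat.add_lt_add_left (σ₂.lt e) _
    · exact Nat.lt_add_right _ (σ₁.pos _).isLt
  I := plug D₂.I j D₁.I
  O := plug D₁.O i D₂.O
  extIn r := Sum.elim (fun s => slotInl _ _ (D₁.extIn s)) (fun s => slotInr _ _ (D₂.extIn s.1))
    ((plugEquiv D₂.I j D₁.I).symm r)
  extOut r := Sum.elim (fun s => slotInr _ _ (D₂.extOut s)) (fun s => slotInl _ _ (D₁.extOut s.1))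
    ((plugEquiv D₁.O i D₂.O).symm r)
  extIn_obj r := by
    obtain ⟨s | s, rfl⟩ := (plugEquiv D₂.I j D₁.I).surjective r
    · rw [plug_get_inl, Equiv.symm_apply_apply]
      exact D₁.extIn_obj s
    · rw [plug_get_inr, Equiv.symm_apply_apply]
      exact D₂.extIn_obj s.1
  extOut_obj r := by
    obtain ⟨s | s, rfl⟩ := (plugEquiv D₁.O i D₂.O).surjective r
    · rw [plug_get_inl, Equiv.symm_apply_apply]
      exact D₂.extOut_obj s
    · rw [plug_get_inr, Equiv.symm_apply_apply]
      exact D₁.extOut_obj s.1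
  in_bij := by
    refine connect_bij D₁.inp D₂.inp D₁.in_bij D₂.in_bij j (slotInl _ _) (slotInr _ _)
      (slotInl_injective _ _) (slotInr_injective _ _) (slotInl_ne_slotInr _ _) ?_ _
      (fun e => Sum.inl (Sum.inl e)) (fun e => Sum.inl (Sum.inr e)) (Sum.inr PUnit.unit) ?_
      (fun _ => rfl) (fun _ => rfl) rfl
    · rintro ⟨x | x, q⟩
      · exact Or.inl ⟨⟨x, q⟩, rfl⟩
      · exact Or.inr ⟨⟨x, q⟩, rfl⟩
    · rintro ((e | e) | e)
      · exact Or.inl ⟨e, rfl⟩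
      · exact Or.inr (Or.inl ⟨e, rfl⟩)
      · exact Or.inr (Or.inr rfl)
  out_bij := by
    refine connect_bij D₂.out D₁.out D₂.out_bij D₁.out_bij i (slotInr _ _) (slotInl _ _)
      (slotInr_injective _ _) (slotInl_injective _ _)
      (fun p q h => slotInl_ne_slotInr _ _ q p h.symm) ?_ _
      (fun e => Sum.inl (Sum.inr e)) (fun e => Sum.inl (Sum.inl e)) (Sum.inr PUnit.unit) ?_
      (fun _ => rfl) (fun _ => rfl) rfl
    · rintro ⟨x | x, q⟩
      · exact Or.inr ⟨⟨x, q⟩, rfl⟩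
      · exact Or.inl ⟨⟨x, q⟩, rfl⟩
    · rintro ((e | e) | e)
      · exact Or.inr (Or.inl ⟨e, rfl⟩)
      · exact Or.inl ⟨e, rfl⟩
      · exact Or.inr (Or.inr rfl)
  ker
    | Sum.inl x => D₁.ker x
    | Sum.inr x => D₂.ker x
  ker_mem
    | Sum.inl x => D₁.ker_mem x
    | Sum.inr x => D₂.ker_mem x
  dom := Sum.elim (Sum.elim D₁.dom D₂.dom) fun _ => B
  cod := Sum.elim (Sum.elim D₁.cod D₂.cod) fun _ => C
  src_obj
    | Sum.inl (Sum.inl e) => D₁.src_obj e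
    | Sum.inl (Sum.inr e) => D₂.src_obj e
    | Sum.inr _ => (D₁.extOut_obj i).trans hB
  tgt_obj
    | Sum.inl (Sum.inl e) => D₁.tgt_obj e
    | Sum.inl (Sum.inr e) => D₂.tgt_obj e
    | Sum.inr _ => (D₂.extIn_obj j).trans hC
  wit
    | Sum.inl (Sum.inl e) => D₁.wit e
    | Sum.inl (Sum.inr e) => D₂.wit e
    | Sum.inr _ => f
  wit_mem
    | Sum.inl (Sum.inl e) => D₁.wit_mem e
    | Sum.inl (Sum.inr e) => D₂.wit_mem e
    | Sum.inr _ => hf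

end Diagram
end CMP

end MarkovPoly

/-! The trace kernel is defined by sampling along one unspecified topological ordering of the
expanded diagram, and for the connected diagram that ordering may interleave the two halves. The
formula becomes visible in another order: all of `D₁`, then the interface vertex on the new wire,
then all of `D₂`. These three blocks are the three nested integrals.

To make the order irrelevant, sampling is moved from growing prefixes to the fixed space `State` of
values at all output slots. Sampling a vertex becomes the operator `resample` on functions of a
state, and a list of vertices acts by the composite `expect`. A vertex reads only the outputs of
vertices feeding it (`vertexInput_congr`), so operators of unlinked vertices commute by Tonelli
(`resample_comm`), and any two topologically sorted enumerations give the same expectation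
(`expect_perm`). With `lintegral_traceMeasure`, which identifies the recursive definition with
`expect`, this yields `lintegral_traceKernel`: integrals against the trace kernel may be computed
along any sorted enumeration, from any initial state.

For the connection, `isTopSorted_connectList` justifies the block order. A state of the connection
is a triple (state of `D₁`, interface value, state of `D₂`) via `mergeState`, and
`resample_vertexLeft`, `resample_vertexMid`, `resample_vertexRight` show that each resampling acts
on one component as in the separate pieces. Hence `expect_connectList`; its blocks are turned back
into trace kernels by `lintegral_traceKernel` for `D₁` and `D₂`, and the result is the integral in
`kscVia_apply`. -/

namespace MarkovPoly

/-! ### Tuples of values, with casts along equal objects handled by heterogeneous equality. -/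

namespace BorelObjects

variable {S : BorelObjects.{u, v}}

theorem castOb_heq {X Y : S.Ob} (h : X = Y) (x : S.carrier X) : HEq (S.castOb h x) x :=
  cast_heq _ _

theorem apply_heq_of_eq {A : List S.Ob} (g : S.Tuple A) {r s : Fin A.length} (h : r = s) :
    HEq (g r) (g s) := by
  subst h
  rfl

/-- With `inner_plugIn` and `outer_plugIn` this makes `plugIn` a bijection, so a kernel on the
composite profile is determined by its values at inputs of the form `V_j(𝐚, 𝐜_{-j})`. -/
theorem plugIn_outer_inner {B : List S.Ob} {i : Fin B.length} {D : List S.Ob}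
    (g : S.Tuple (plug B i D)) : plugIn (outer g) (inner g) = g := by
  funext r
  unfold plugIn
  split
  · next s h =>
    exact eq_of_heq ((castOb_heq _ _).trans ((castOb_heq _ _).trans
      (apply_heq_of_eq g ((Equiv.symm_apply_eq _).1 h).symm)))
  · next s h =>
    exact eq_of_heq ((castOb_heq _ _).trans ((castOb_heq _ _).trans
      (apply_heq_of_eq g ((Equiv.symm_apply_eq _).1 h).symm)))

theorem plugIn_apply_inl_heq {B : List S.Ob} {i : Fin B.length} {D : List S.Ob}
    (c : S.Punctured B i) (d : S.Tuple D) (s : Fin D.length) :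
    HEq (plugIn c d (plugEquiv B i D (Sum.inl s))) (d s) := by
  conv_rhs => rw [← inner_plugIn c d]
  exact (castOb_heq _ _).symm

theorem plugIn_apply_inr_heq {B : List S.Ob} {i : Fin B.length} {D : List S.Ob}
    (c : S.Punctured B i) (d : S.Tuple D) (s : {s : Fin B.length // s ≠ i}) :
    HEq (plugIn c d (plugEquiv B i D (Sum.inr s))) (c s) := by
  conv_rhs => rw [← outer_plugIn c d]
  exact (castOb_heq _ _).symm

theorem insertAt_apply_self_heq {C : List S.Ob} {j : Fin C.length} (c : S.Punctured C j)
    (z : S.carrier (C.get j)) : HEq (insertAt c z j) z := by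
  simp [insertAt]

theorem insertAt_apply_ne {C : List S.Ob} {j : Fin C.length} (c : S.Punctured C j)
    (z : S.carrier (C.get j)) (s : {s : Fin C.length // s ≠ j}) : insertAt c z s.1 = c s := by
  simp [insertAt, s.2]

end BorelObjects

/-! ### Topologically sorted lists of vertices. -/

namespace Wiring

variable {Ob : Type u} (G : Wiring.{u, w} Ob)

/-- There is a wire from `a` to `b`. -/
def Feeds (a b : G.V) : Prop := ∃ e, (G.src e).1 = a ∧ (G.tgt e).1 = b

/-- A list of vertices along which no wire goes backward. -/
def IsTopSorted (l : List G.V) : Prop := l.Pairwise fun a b => ¬ G.Feeds b a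

namespace TopOrder

variable {G} (σ : G.TopOrder)

/-- The vertices at the first `r` positions, in order. -/
def prefixList : ∀ r : ℕ, r ≤ σ.n → List G.V
  | 0, _ => []
  | r + 1, h => prefixList r (Nat.le_of_succ_le h) ++ [σ.pos.symm ⟨r, h⟩]

theorem mem_prefixList (x : G.V) : ∀ (r : ℕ) (h : r ≤ σ.n),
    x ∈ σ.prefixList r h ↔ (σ.pos x : ℕ) < r
  | 0, _ => by simp [prefixList]
  | r + 1, h => by
    rw [prefixList, List.mem_append, mem_prefixList x r, List.mem_singleton, Equiv.eq_symm_apply,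
      Fin.ext_iff]
    exact Nat.lt_succ_iff_lt_or_eq.symm

theorem nodup_prefixList : ∀ (r : ℕ) (h : r ≤ σ.n), (σ.prefixList r h).Nodup
  | 0, _ => List.nodup_nil
  | r + 1, h => by
    refine List.Nodup.append (nodup_prefixList r _) (List.nodup_singleton _) ?_
    rw [List.disjoint_singleton, mem_prefixList]
    simp

theorem isTopSorted_prefixList : ∀ (r : ℕ) (h : r ≤ σ.n), G.IsTopSorted (σ.prefixList r h)
  | 0, _ => List.Pairwise.nil
  | r + 1, h => by
    refine List.pairwise_append.2 ⟨isTopSorted_prefixList r _, List.pairwise_singleton _ _, ?_⟩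
    rintro a ha b hb ⟨e, h1, h2⟩
    rw [List.mem_singleton] at hb
    rw [mem_prefixList] at ha
    have := σ.lt e
    rw [h1, h2, hb, Equiv.apply_symm_apply, Fin.lt_def] at this
    exact absurd ha (Nat.lt_asymm this)

/-- All vertices, in order. -/
def toList : List G.V := σ.prefixList σ.n le_rfl

theorem mem_toList (x : G.V) : x ∈ σ.toList :=
  (σ.mem_prefixList x _ _).2 (σ.pos x).isLt

theorem nodup_toList : σ.toList.Nodup := σ.nodup_prefixList _ _

theorem isTopSorted_toList : G.IsTopSorted σ.toList := σ.isTopSorted_prefixList _ _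

end TopOrder

end Wiring

/-! ### Vertex inputs as functions of a state of the whole diagram. -/

namespace KSCDiagram

variable {P : MarkovPolycategory.{u, v}} (D : KSCDiagram.{u, v, w} P)

/-- Values at the output slots of all the vertices. -/
abbrev State : Type (max v w) := ∀ x : D.V, P.Tuple (D.out x)

/-- The value supplied by a wire or an external input, in a given state. -/
noncomputable def suppliedBy (x : P.Tuple D.I) (y : D.State) :
    ∀ s : D.W ⊕ Fin D.I.length, P.carrier (D.inOb (D.inEquiv s))
  | Sum.inl e => P.castOb (D.wire_obj e) (y (D.src e).1 (D.src e).2)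
  | Sum.inr s => P.castOb (D.extIn_obj s).symm (x s)

/-- The input tuple of a vertex, in a given state. -/
noncomputable def vertexInput (a : D.V) (x : P.Tuple D.I) (y : D.State) : P.Tuple (D.inp a) :=
  fun q => P.castOb (congrArg D.inOb (D.inEquiv.apply_symm_apply ⟨a, q⟩))
    (D.suppliedBy x y (D.inEquiv.symm ⟨a, q⟩))

theorem vertexInput_inEquiv_heq (x : P.Tuple D.I) (y : D.State) (s : D.W ⊕ Fin D.I.length) :
    HEq (D.vertexInput (D.inEquiv s).1 x y (D.inEquiv s).2) (D.suppliedBy x y s) := by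
  refine (BorelObjects.castOb_heq _ _).trans ?_
  have : D.inEquiv.symm ⟨(D.inEquiv s).1, (D.inEquiv s).2⟩ = s := D.inEquiv.symm_apply_apply s
  rw [this]

theorem vertexInput_tgt_heq (x : P.Tuple D.I) (y : D.State) (e : D.W) :
    HEq (D.vertexInput (D.tgt e).1 x y (D.tgt e).2) (y (D.src e).1 (D.src e).2) :=
  (D.vertexInput_inEquiv_heq x y (Sum.inl e)).trans (BorelObjects.castOb_heq (D.wire_obj e) _)

theorem vertexInput_extIn_heq (x : P.Tuple D.I) (y : D.State) (s : Fin D.I.length) :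
    HEq (D.vertexInput (D.extIn s).1 x y (D.extIn s).2) (x s) :=
  (D.vertexInput_inEquiv_heq x y (Sum.inr s)).trans
    (BorelObjects.castOb_heq (D.extIn_obj s).symm _)

/-- The slot `p` is a variable so that `h` can be eliminated: in a connection, external slots are
found through the inverse of `plugEquiv` and are known only up to a propositional equality. -/
theorem vertexInput_heq_of_extIn (x : P.Tuple D.I) (y : D.State) {s : Fin D.I.length}
    {p : Σ a : D.V, Fin (D.inp a).length} (h : D.extIn s = p) :
    HEq (D.vertexInput p.1 x y p.2) (x s) := by
  subst h
  exact D.vertexInput_extIn_heq x y s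

/-- Locality: each input slot is supplied by an external value or by a wire, and the source of that
wire feeds `a`. This is the only fact about wiring behind the commutation of resamplings. -/
theorem vertexInput_congr {a : D.V} (x : P.Tuple D.I) {y y' : D.State}
    (h : ∀ b, D.Feeds b a → y b = y' b) : D.vertexInput a x y = D.vertexInput a x y' := by
  funext q
  have hs : (D.inEquiv (D.inEquiv.symm ⟨a, q⟩)).1 = a := by rw [Equiv.apply_symm_apply]
  unfold vertexInput
  congr 1
  -- The type of the supplied value depends on the supplier, so the supplier is made a variable
  -- before the case split; `hs` retains that it supplies a slot of `a`.
  generalize D.inEquiv.symm ⟨a, q⟩ = s at hs ⊢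
  rcases s with e | s
  · simp only [suppliedBy, h _ ⟨e, rfl, hs⟩]
  · rfl

theorem measurable_vertexInput (a : D.V) (x : P.Tuple D.I) : Measurable (D.vertexInput a x) := by
  refine measurable_pi_lambda _ fun q => (P.measurable_castOb _).comp ?_
  generalize D.inEquiv.symm ⟨a, q⟩ = s
  rcases s with e | s
  · exact (P.measurable_castOb _).comp ((measurable_pi_apply _).comp (measurable_pi_apply _))
  · exact measurable_const

/-- The output kernel of a vertex, in a given state. -/
noncomputable def stateKernel (a : D.V) (x : P.Tuple D.I) : Kernel D.State (P.Tuple (D.out a)) :=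
  (D.ker a).comap (D.vertexInput a x) (D.measurable_vertexInput a x)

instance (a : D.V) (x : P.Tuple D.I) : IsMarkovKernel (D.stateKernel a x) := by
  unfold stateKernel
  infer_instance

/-! ### Resampling operators and independence of the order of sampling. -/

open Classical in
/-- The expectation of `g` after resampling the output of the vertex `a`. -/
noncomputable def resample (x : P.Tuple D.I) (a : D.V) (g : D.State → ENNReal) (y : D.State) :
    ENNReal :=
  ∫⁻ z, g (Function.update y a z) ∂(D.ker a (D.vertexInput a x y))

theorem measurable_resample (x : P.Tuple D.I) (a : D.V) {g : D.State → ENNReal}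
    (hg : Measurable g) : Measurable (D.resample x a g) := by
  classical
  have h : Measurable fun p : D.State × P.Tuple (D.out a) => g (Function.update p.1 a p.2) :=
    hg.comp measurable_update'
  have := h.lintegral_kernel_prod_right' (κ := D.stateKernel a x)
  convert this using 2 with y
  simp only [resample, stateKernel, Kernel.comap_apply]

/-- Without a wire between `a` and `b`, neither kernel sees the new value of the other vertex. Both
sides are then iterated integrals of one function against two fixed measures, and Tonelli applies.
-/
theorem resample_comm (x : P.Tuple D.I) {a b : D.V} (hne : a ≠ b) (hab : ¬ D.Feeds a b)
    (hba : ¬ D.Feeds b a) {g : D.State → ENNReal} (hg : Measurable g) :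
    D.resample x a (D.resample x b g) = D.resample x b (D.resample x a g) := by
  classical
  funext y
  have h1 : ∀ z, D.vertexInput b x (Function.update y a z) = D.vertexInput b x y := fun z =>
    D.vertexInput_congr x fun c hc => Function.update_of_ne (by rintro rfl; exact hab hc) _ _
  have h2 : ∀ z, D.vertexInput a x (Function.update y b z) = D.vertexInput a x y := fun z =>
    D.vertexInput_congr x fun c hc => Function.update_of_ne (by rintro rfl; exact hba hc) _ _
  have hm : Measurable fun p : P.Tuple (D.out a) × P.Tuple (D.out b) =>
      g (Function.update (Function.update y a p.1) b p.2) := by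
    refine hg.comp ?_
    exact measurable_update'.comp
      (((measurable_update y).comp measurable_fst).prodMk measurable_snd)
  simp only [resample, h1, h2]
  rw [lintegral_lintegral_swap hm.aemeasurable]
  simp only [Function.update_comm hne]

/-- The expectation of `g` after sampling the vertices of a list, in order. -/
noncomputable def expect (x : P.Tuple D.I) : List D.V → (D.State → ENNReal) → D.State → ENNReal
  | [], g => g
  | a :: l, g => D.resample x a (expect x l g)

theorem measurable_expect (x : P.Tuple D.I) {g : D.State → ENNReal} (hg : Measurable g) :
    ∀ l : List D.V, Measurable (D.expect x l g)
  | [] => hg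
  | a :: l => D.measurable_resample x a (measurable_expect x hg l)

theorem expect_append (x : P.Tuple D.I) (g : D.State → ENNReal) :
    ∀ l l' : List D.V, D.expect x (l ++ l') g = D.expect x l (D.expect x l' g)
  | [], _ => rfl
  | a :: l, l' => congrArg (D.resample x a) (expect_append x g l l')

/-- The vertex `a` is carried to the front by adjacent transpositions, one for each element of `s`.
-/
theorem expect_append_cons (x : P.Tuple D.I) {a : D.V} {g : D.State → ENNReal} (hg : Measurable g)
    (t : List D.V) : ∀ s : List D.V,
    (∀ b ∈ s, b ≠ a ∧ ¬ D.Feeds a b ∧ ¬ D.Feeds b a) →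
      D.expect x (s ++ a :: t) g = D.expect x (a :: (s ++ t)) g
  | [], _ => rfl
  | b :: s, h => by
    obtain ⟨h1, h2, h3⟩ := h b List.mem_cons_self
    have ih := expect_append_cons x hg t s fun c hc => h c (List.mem_cons_of_mem _ hc)
    calc D.resample x b (D.expect x (s ++ a :: t) g)
        = D.resample x b (D.resample x a (D.expect x (s ++ t) g)) := by rw [ih]; rfl
      _ = _ := D.resample_comm x h1 h3 h2 (D.measurable_expect x hg _)

/-- Induction on the first list: its head `a` is brought to the front of the second list. A vertex
preceding `a` in the second list follows it in the first, so sortedness of the two lists excludes a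
wire in either direction. -/
theorem expect_perm (x : P.Tuple D.I) {g : D.State → ENNReal} (hg : Measurable g) :
    ∀ l l' : List D.V, l.Perm l' → l.Nodup → D.IsTopSorted l → D.IsTopSorted l' →
      D.expect x l g = D.expect x l' g
  | [], l', hp, _, _, _ => by rw [hp.nil_eq]
  | a :: l, l', hp, hn, hl, hl' => by
    obtain ⟨s, t, rfl⟩ := List.append_of_mem (hp.mem_iff.1 List.mem_cons_self)
    have hp' : l.Perm (s ++ t) := (hp.trans List.perm_middle).cons_inv
    have hnd := List.nodup_cons.1 hn
    have hmem : ∀ b ∈ s, b ∈ l := fun b hb => hp'.mem_iff.2 (List.mem_append_left _ hb)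
    rw [D.expect_append_cons x hg t s fun b hb => ⟨?_, ?_, ?_⟩]
    · exact congrArg (D.resample x a) (expect_perm x hg l (s ++ t) hp' hnd.2
        (List.pairwise_cons.1 hl).2 (hl'.sublist
          (List.Sublist.append_left (List.sublist_cons_self a t) s)))
    · rintro rfl
      exact hnd.1 (hmem _ hb)
    · exact (List.pairwise_append.1 hl').2.2 b hb a List.mem_cons_self
    · exact (List.pairwise_cons.1 hl).1 b (hmem b hb)

/-! ### The recursive trace measure as iterated resampling. -/

section Along

variable (σ : D.TopOrder)

/-- Complete the outputs of the first `r` vertices by those of a given state. -/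
def fill (y₀ : D.State) {r : ℕ} (p : D.Prefix σ r) : D.State :=
  fun a => if h : (σ.pos a : ℕ) < r then p ⟨a, h⟩ else y₀ a

theorem measurable_fill (y₀ : D.State) (r : ℕ) :
    Measurable (D.fill σ y₀ : D.Prefix σ r → D.State) := by
  refine measurable_pi_lambda _ fun a => ?_
  by_cases h : (σ.pos a : ℕ) < r
  · simp only [fill, h, dite_true]
    exact measurable_pi_apply _
  · simp only [fill, h, dite_false]
    exact measurable_const

/-- The vertex at position `r` is fed only from earlier positions, so its input never reads the part
completed by `y₀`. This is why the initial state may be arbitrary. -/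
theorem vertexInput_fill (y₀ : D.State) (r : Fin σ.n) (x : P.Tuple D.I) (p : D.Prefix σ r) :
    D.vertexInput (σ.pos.symm r) x (D.fill σ y₀ p) = D.inputTuple σ r (x, p) := by
  funext q
  have key : ∀ (s : D.W ⊕ Fin D.I.length) (ht : D.inEquiv s = ⟨σ.pos.symm r, q⟩),
      P.castOb (congrArg D.inOb ht) (D.suppliedBy x (D.fill σ y₀ p) s) =
        D.suppliedValue σ r q s ht (x, p) := by
    rintro (e | s) ht
    · refine eq_of_heq ((BorelObjects.castOb_heq _ _).trans
        ((BorelObjects.castOb_heq (D.wire_obj e) _).trans (HEq.trans ?_ (BorelObjects.castOb_heq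
          ((D.wire_obj e).trans (congrArg D.inOb ht)) _).symm)))
      have h : (σ.pos (D.src e).1 : ℕ) < r := by
        have h1 := σ.lt e
        rw [← D.inEquiv_inl, congrArg Sigma.fst ht, Equiv.apply_symm_apply] at h1
        exact h1
      simp only [fill, h, dite_true]
      rfl
    · exact eq_of_heq ((BorelObjects.castOb_heq _ _).trans
        ((BorelObjects.castOb_heq (D.extIn_obj s).symm _).trans (BorelObjects.castOb_heq
          ((D.extIn_obj s).symm.trans (congrArg D.inOb ht)) _).symm))
  exact key _ _

open Classical in
theorem fill_extend (y₀ : D.State) (r : Fin σ.n) (p : D.Prefix σ r)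
    (z : P.Tuple (D.out (σ.pos.symm r))) :
    D.fill σ y₀ (D.extend σ r (p, z)) = Function.update (D.fill σ y₀ p) (σ.pos.symm r) z := by
  funext a
  by_cases ha : a = σ.pos.symm r
  · subst ha
    simp [fill, extend]
  · have h1 : (σ.pos a : ℕ) ≠ r := fun h => ha (by
      rw [Equiv.eq_symm_apply]
      exact Fin.ext h)
    rw [Function.update_of_ne ha]
    by_cases h : (σ.pos a : ℕ) < r
    · have h2 : (σ.pos a : ℕ) < r + 1 := by omega
      simp only [fill, extend, h, h2, dite_true]
    · have h2 : ¬ (σ.pos a : ℕ) < r + 1 := by omega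
      simp only [fill, h, h2, dite_false]

/-- The recursion adds vertices at the end, whereas `expect` peels them off at the front. The last
vertex is therefore absorbed into the test function, which is why the induction has to quantify over
`g`. -/
theorem lintegral_traceMeasure (y₀ : D.State) (x : P.Tuple D.I) :
    ∀ (r : ℕ) (h : r ≤ σ.n) {g : D.State → ENNReal}, Measurable g →
      ∫⁻ p, g (D.fill σ y₀ p) ∂(D.traceMeasure σ r h x) = D.expect x (σ.prefixList r h) g y₀
  | 0, _, g, hg => by
    have : D.fill σ y₀ (r := 0) (fun x => absurd x.2 (Nat.not_lt_zero _)) = y₀ := by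
      funext a
      simp [fill]
    have hgf : Measurable fun p : D.Prefix σ 0 => g (D.fill σ y₀ p) :=
      hg.comp (D.measurable_fill σ y₀ 0)
    rw [traceMeasure, Kernel.const_apply, lintegral_dirac' _ hgf, this]
    rfl
  | r + 1, h, g, hg => by
    have hgf : Measurable fun p : D.Prefix σ (r + 1) => g (D.fill σ y₀ p) :=
      hg.comp (D.measurable_fill σ y₀ (r + 1))
    have hme := D.measurable_extend σ ⟨r, h⟩
    -- The induction hypothesis is used for `g` already averaged over the output of the vertex at
    -- position `r`.
    have ih := lintegral_traceMeasure y₀ x r (Nat.le_of_succ_le h)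
      (D.measurable_resample x (σ.pos.symm ⟨r, h⟩) hg)
    rw [traceMeasure, Kernel.map_apply _ hme, lintegral_map hgf hme, Wiring.TopOrder.prefixList,
      expect_append]
    refine (Kernel.lintegral_compProd _ _ _ (hgf.comp hme)).trans (Eq.trans ?_ ih)
    refine lintegral_congr fun p => ?_
    simp only [Function.comp_def, Kernel.comap_apply, resample]
    rw [← D.vertexInput_fill σ y₀ ⟨r, h⟩ x p]
    refine lintegral_congr fun z => ?_
    rw [← D.fill_extend σ y₀ ⟨r, h⟩ p z]

/-- Underlying spaces may be empty, so an initial state is not automatic. Once an external input is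
given, the full trace measure is a probability measure, and its space of outcomes must be nonempty.
-/
theorem nonempty_state (x : P.Tuple D.I) : Nonempty D.State := by
  obtain ⟨σ⟩ := D.nonempty_topOrder
  obtain ⟨p⟩ := (D.traceMeasure σ σ.n le_rfl x).nonempty_of_neZero
  exact ⟨fun a => p ⟨a, (σ.pos a).isLt⟩⟩

end Along

/-- The external output tuple of a state. -/
def stateOutput (y : D.State) : P.Tuple D.O :=
  fun s => P.castOb (D.extOut_obj s) (y (D.extOut s).1 (D.extOut s).2)

theorem stateOutput_heq (y : D.State) (s : Fin D.O.length) {p : Σ a : D.V, Fin (D.out a).length}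
    (h : D.extOut s = p) : HEq (D.stateOutput y s) (y p.1 p.2) := by
  subst h
  exact BorelObjects.castOb_heq _ _

theorem measurable_stateOutput : Measurable D.stateOutput :=
  measurable_pi_lambda _ fun _ => (P.measurable_castOb _).comp
    ((measurable_pi_apply _).comp (measurable_pi_apply _))

/-- The trace kernel is computed by sampling the vertices along any topologically sorted
enumeration, starting from an arbitrary state. -/
theorem lintegral_traceKernel {l : List D.V} (hn : l.Nodup) (hm : ∀ a, a ∈ l)
    (hl : D.IsTopSorted l) (x : P.Tuple D.I) (y₀ : D.State) {g : P.Tuple D.O → ENNReal}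
    (hg : Measurable g) :
    ∫⁻ o, g o ∂(D.traceKernel x) = D.expect x l (fun y => g (D.stateOutput y)) y₀ := by
  -- The ordering used in the definition of `traceKernel`; nothing is known about it, so `l` is
  -- compared with it through `expect_perm`.
  let σ := D.nonempty_topOrder.some
  have hgo : Measurable fun y => g (D.stateOutput y) := hg.comp D.measurable_stateOutput
  have ho := D.measurable_outputTuple σ
  have hp : l.Perm σ.toList :=
    (List.perm_ext_iff_of_nodup hn σ.nodup_toList).2 fun a => by simp [hm, σ.mem_toList]
  rw [D.expect_perm x hgo l σ.toList hp hn hl σ.isTopSorted_toList]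
  refine Eq.trans ?_ (D.lintegral_traceMeasure σ y₀ x σ.n le_rfl hgo)
  change ∫⁻ o, g o ∂((D.traceMeasure σ σ.n le_rfl).map (D.outputTuple σ) x) = _
  rw [Kernel.map_apply _ ho, lintegral_map hg ho]
  refine lintegral_congr fun p => congrArg g ?_
  funext s
  -- After all `σ.n` positions have been sampled, `fill` takes no coordinate from `y₀`.
  simp [stateOutput, outputTuple, fill]

/-- Sampling in a diagram simulates sampling in another one if it does so at each vertex. -/
theorem expect_map {D' : KSCDiagram.{u, v, w} P} (ι : D'.V → D.V) (m : D'.State → D.State)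
    {x : P.Tuple D.I} {x' : P.Tuple D'.I}
    (h : ∀ a g y, D.resample x (ι a) g (m y) = D'.resample x' a (fun y => g (m y)) y)
    (g : D.State → ENNReal) : ∀ (l : List D'.V) (y : D'.State),
    D.expect x (l.map ι) g (m y) = D'.expect x' l (fun y => g (m y)) y
  | [], _ => rfl
  | a :: l, y => (h a _ y).trans
      (congrArg (fun k => D'.resample x' a k y) (funext fun y => expect_map ι m h g l y))

end KSCDiagram

end MarkovPoly

namespace MarkovPoly

/-! ### Vertices and wires of the expanded connection. -/

namespace CMP.Diagram

variable {𝒞 : ColorSystem.{uK, vK, wM}} {P : CMP.{u, v} 𝒞} (D₁ D₂ : Diagram.{u, v, w} P)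
  (i : Fin D₁.O.length) (j : Fin D₂.I.length) {B C : P.Ob} (hB : D₁.O.get i = B)
  (hC : D₂.I.get j = C) (f : P.χ B ⟶ P.χ C) (hf : f ∈ P.Int B C)

/-- The interface expansion of a connection. -/
abbrev connectExpansion : KSCDiagram.{u, v, w} P.toMarkovPolycategory :=
  (D₁.connect D₂ i j hB hC f hf).expansion

/-- The vertices of the expansion of the first diagram, in that of the connection. -/
def vertexLeft : D₁.expansion.V → (D₁.connectExpansion D₂ i j hB hC f hf).V :=
  Sum.map Sum.inl fun e => Sum.inl (Sum.inl e)

/-- The vertices of the expansion of the second diagram, in that of the connection. -/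
def vertexRight : D₂.expansion.V → (D₁.connectExpansion D₂ i j hB hC f hf).V :=
  Sum.map Sum.inr fun e => Sum.inl (Sum.inr e)

/-- The interface vertex on the connecting wire. -/
def vertexMid : (D₁.connectExpansion D₂ i j hB hC f hf).V := Sum.inr (Sum.inr PUnit.unit)

theorem vertexLeft_injective : Function.Injective (vertexLeft D₁ D₂ i j hB hC f hf) := by
  rintro (a | a) (b | b) h <;> cases h <;> rfl

theorem vertexRight_injective : Function.Injective (vertexRight D₁ D₂ i j hB hC f hf) := by
  rintro (a | a) (b | b) h <;> cases h <;> rfl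

theorem vertexLeft_ne_vertexRight (a : D₁.expansion.V) (b : D₂.expansion.V) :
    vertexLeft D₁ D₂ i j hB hC f hf a ≠ vertexRight D₁ D₂ i j hB hC f hf b := by
  rcases a with a | a <;> rcases b with b | b <;> rintro ⟨⟩

theorem vertexLeft_ne_vertexMid (a : D₁.expansion.V) :
    vertexLeft D₁ D₂ i j hB hC f hf a ≠ vertexMid D₁ D₂ i j hB hC f hf := by
  rcases a with a | a <;> rintro ⟨⟩

theorem vertexRight_ne_vertexMid (a : D₂.expansion.V) :
    vertexRight D₁ D₂ i j hB hC f hf a ≠ vertexMid D₁ D₂ i j hB hC f hf := by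
  rcases a with a | a <;> rintro ⟨⟩

theorem connect_vertex_cases (c : (D₁.connectExpansion D₂ i j hB hC f hf).V) :
    (∃ a, c = vertexLeft D₁ D₂ i j hB hC f hf a) ∨ (∃ a, c = vertexRight D₁ D₂ i j hB hC f hf a) ∨
      c = vertexMid D₁ D₂ i j hB hC f hf := by
  rcases c with (a | a) | ((e | e) | e)
  · exact Or.inl ⟨Sum.inl a, rfl⟩
  · exact Or.inr (Or.inl ⟨Sum.inl a, rfl⟩)
  · exact Or.inl ⟨Sum.inr e, rfl⟩
  · exact Or.inr (Or.inl ⟨Sum.inr e, rfl⟩)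
  · exact Or.inr (Or.inr rfl)

/-- Every wire of the connection is split in two, which gives six families: the two halves of wires
of `D₁`, of wires of `D₂`, and of the new wire. Only the last two halves leave a block, and both go
forward. -/
theorem connect_feeds_cases {c d : (D₁.connectExpansion D₂ i j hB hC f hf).V}
    (h : (D₁.connectExpansion D₂ i j hB hC f hf).Feeds c d) :
    (∃ a b, c = vertexLeft D₁ D₂ i j hB hC f hf a ∧ d = vertexLeft D₁ D₂ i j hB hC f hf b ∧
        D₁.expansion.Feeds a b) ∨
      (∃ a b, c = vertexRight D₁ D₂ i j hB hC f hf a ∧ d = vertexRight D₁ D₂ i j hB hC f hf b ∧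
        D₂.expansion.Feeds a b) ∨
      (∃ a, c = vertexLeft D₁ D₂ i j hB hC f hf a ∧ d = vertexMid D₁ D₂ i j hB hC f hf) ∨
      ∃ b, c = vertexMid D₁ D₂ i j hB hC f hf ∧ d = vertexRight D₁ D₂ i j hB hC f hf b := by
  obtain ⟨((e | e) | e) | ((e | e) | e), rfl, rfl⟩ := h
  · exact Or.inl ⟨_, _, rfl, rfl, Sum.inl e, rfl, rfl⟩
  · exact Or.inr (Or.inl ⟨_, _, rfl, rfl, Sum.inl e, rfl, rfl⟩)
  · exact Or.inr (Or.inr (Or.inl ⟨Sum.inl (D₁.extOut i).1, rfl, rfl⟩))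
  · exact Or.inl ⟨_, _, rfl, rfl, Sum.inr e, rfl, rfl⟩
  · exact Or.inr (Or.inl ⟨_, _, rfl, rfl, Sum.inr e, rfl, rfl⟩)
  · exact Or.inr (Or.inr (Or.inr ⟨Sum.inl (D₂.extIn j).1, rfl, rfl⟩))

theorem connect_extIn_inl (s : Fin D₁.I.length) :
    (D₁.connect D₂ i j hB hC f hf).extIn (plugEquiv D₂.I j D₁.I (Sum.inl s)) =
      slotInl _ _ (D₁.extIn s) :=
  congrArg (Sum.elim (fun s => slotInl D₁.inp D₂.inp (D₁.extIn s))
    fun s : {s // s ≠ j} => slotInr _ _ (D₂.extIn s.1)) (Equiv.symm_apply_apply _ (Sum.inl s))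

theorem connect_extIn_inr (s : {s : Fin D₂.I.length // s ≠ j}) :
    (D₁.connect D₂ i j hB hC f hf).extIn (plugEquiv D₂.I j D₁.I (Sum.inr s)) =
      slotInr _ _ (D₂.extIn s.1) :=
  congrArg (Sum.elim (fun s => slotInl D₁.inp D₂.inp (D₁.extIn s))
    fun s : {s // s ≠ j} => slotInr _ _ (D₂.extIn s.1)) (Equiv.symm_apply_apply _ (Sum.inr s))

theorem connect_extOut_inl (s : Fin D₂.O.length) :
    (D₁.connect D₂ i j hB hC f hf).extOut (plugEquiv D₁.O i D₂.O (Sum.inl s)) =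
      slotInr _ _ (D₂.extOut s) :=
  congrArg (Sum.elim (fun s => slotInr D₁.out D₂.out (D₂.extOut s))
    fun s : {s // s ≠ i} => slotInl _ _ (D₁.extOut s.1)) (Equiv.symm_apply_apply _ (Sum.inl s))

theorem connect_extOut_inr (s : {s : Fin D₁.O.length // s ≠ i}) :
    (D₁.connect D₂ i j hB hC f hf).extOut (plugEquiv D₁.O i D₂.O (Sum.inr s)) =
      slotInl _ _ (D₁.extOut s.1) :=
  congrArg (Sum.elim (fun s => slotInr D₁.out D₂.out (D₂.extOut s))
    fun s : {s // s ≠ i} => slotInl _ _ (D₁.extOut s.1)) (Equiv.symm_apply_apply _ (Sum.inr s))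

/-! ### The block enumeration of the connection. -/

/-- First the vertices of the first diagram, then the connecting interface vertex, then the vertices
of the second diagram. -/
def connectList (l₁ : List D₁.expansion.V) (l₂ : List D₂.expansion.V) :
    List (D₁.connectExpansion D₂ i j hB hC f hf).V :=
  l₁.map (vertexLeft D₁ D₂ i j hB hC f hf) ++
    vertexMid D₁ D₂ i j hB hC f hf :: l₂.map (vertexRight D₁ D₂ i j hB hC f hf)

variable {D₁ D₂} {l₁ : List D₁.expansion.V} {l₂ : List D₂.expansion.V}

theorem mem_connectList (h₁ : ∀ a, a ∈ l₁) (h₂ : ∀ a, a ∈ l₂)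
    (c : (D₁.connectExpansion D₂ i j hB hC f hf).V) :
    c ∈ connectList D₁ D₂ i j hB hC f hf l₁ l₂ := by
  rcases connect_vertex_cases D₁ D₂ i j hB hC f hf c with ⟨a, rfl⟩ | ⟨a, rfl⟩ | rfl
  · exact List.mem_append_left _ (List.mem_map_of_mem (h₁ a))
  · exact List.mem_append_right _ (List.mem_cons_of_mem _ (List.mem_map_of_mem (h₂ a)))
  · exact List.mem_append_right _ List.mem_cons_self

theorem nodup_connectList (h₁ : l₁.Nodup) (h₂ : l₂.Nodup) :
    (connectList D₁ D₂ i j hB hC f hf l₁ l₂).Nodup := by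
  refine List.Nodup.append (h₁.map (vertexLeft_injective _ _ _ _ _ _ _ _))
    (List.nodup_cons.2 ⟨?_, h₂.map (vertexRight_injective _ _ _ _ _ _ _ _)⟩) ?_
  · rw [List.mem_map]
    rintro ⟨a, -, h⟩
    exact vertexRight_ne_vertexMid _ _ _ _ _ _ _ _ _ h
  · intro c hc hc'
    obtain ⟨a, -, rfl⟩ := List.mem_map.1 hc
    rcases List.mem_cons.1 hc' with h | h
    · exact vertexLeft_ne_vertexMid _ _ _ _ _ _ _ _ _ h
    · obtain ⟨b, -, h⟩ := List.mem_map.1 h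
      exact vertexLeft_ne_vertexRight _ _ _ _ _ _ _ _ _ _ h.symm

theorem isTopSorted_connectList (h₁ : D₁.expansion.IsTopSorted l₁)
    (h₂ : D₂.expansion.IsTopSorted l₂) :
    (D₁.connectExpansion D₂ i j hB hC f hf).IsTopSorted
      (connectList D₁ D₂ i j hB hC f hf l₁ l₂) := by
  have hlr := vertexLeft_ne_vertexRight D₁ D₂ i j hB hC f hf
  have hrl := fun a b => (hlr a b).symm
  have hlm := vertexLeft_ne_vertexMid D₁ D₂ i j hB hC f hf
  have hml := fun a => (hlm a).symm
  have hrm := vertexRight_ne_vertexMid D₁ D₂ i j hB hC f hf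
  have hmr := fun a => (hrm a).symm
  have il := fun a b => (vertexLeft_injective D₁ D₂ i j hB hC f hf).eq_iff (a := a) (b := b)
  have ir := fun a b => (vertexRight_injective D₁ D₂ i j hB hC f hf).eq_iff (a := a) (b := b)
  refine List.pairwise_append.2 ⟨?_, List.pairwise_cons.2 ⟨?_, ?_⟩, ?_⟩
  -- Between two vertices of the first block only the first kind of wire is possible, and
  -- injectivity of `vertexLeft` brings it back to a wire of the expansion of `D₁`.
  · refine List.pairwise_map.2 (h₁.imp fun {a b} hab h => hab ?_)
    have := connect_feeds_cases D₁ D₂ i j hB hC f hf h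
    simpa [hlr, hlm, il] using this
  · intro c hc h
    obtain ⟨a, -, rfl⟩ := List.mem_map.1 hc
    have := connect_feeds_cases D₁ D₂ i j hB hC f hf h
    simp [hrl, hrm, hmr, hml] at this
  · refine List.pairwise_map.2 (h₂.imp fun {a b} hab h => hab ?_)
    have := connect_feeds_cases D₁ D₂ i j hB hC f hf h
    simpa [hrl, hrm, ir] using this
  · intro c hc d hd h
    obtain ⟨a, -, rfl⟩ := List.mem_map.1 hc
    have := connect_feeds_cases D₁ D₂ i j hB hC f hf h
    rcases List.mem_cons.1 hd with rfl | hd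
    · simp [hlr, hlm, hmr, hml] at this
    · obtain ⟨b, -, rfl⟩ := List.mem_map.1 hd
      simp [hlr, hlm, hrl, hrm] at this

/-! ### Merged states: what each vertex reads and what the diagram outputs. -/

/-- A state of the connection, from states of the two diagrams and of the connecting interface
vertex. -/
def mergeState (y₁ : D₁.expansion.State) (z : P.Tuple [C]) (y₂ : D₂.expansion.State) :
    (D₁.connectExpansion D₂ i j hB hC f hf).State
  | Sum.inl (Sum.inl a) => y₁ (Sum.inl a)
  | Sum.inl (Sum.inr a) => y₂ (Sum.inl a)
  | Sum.inr (Sum.inl (Sum.inl e)) => y₁ (Sum.inr e)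
  | Sum.inr (Sum.inl (Sum.inr e)) => y₂ (Sum.inr e)
  | Sum.inr (Sum.inr _) => z

/-- The input slots of the expansion of the first diagram, in that of the connection. -/
def inSlotLeft : (Σ a : D₁.expansion.V, Fin (D₁.expansion.inp a).length) →
    Σ a : (D₁.connectExpansion D₂ i j hB hC f hf).V,
      Fin ((D₁.connectExpansion D₂ i j hB hC f hf).inp a).length
  | ⟨Sum.inl a, q⟩ => ⟨Sum.inl (Sum.inl a), q⟩
  | ⟨Sum.inr e, q⟩ => ⟨Sum.inr (Sum.inl (Sum.inl e)), q⟩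

/-- The input slots of the expansion of the second diagram, in that of the connection. -/
def inSlotRight : (Σ a : D₂.expansion.V, Fin (D₂.expansion.inp a).length) →
    Σ a : (D₁.connectExpansion D₂ i j hB hC f hf).V,
      Fin ((D₁.connectExpansion D₂ i j hB hC f hf).inp a).length
  | ⟨Sum.inl a, q⟩ => ⟨Sum.inl (Sum.inr a), q⟩
  | ⟨Sum.inr e, q⟩ => ⟨Sum.inr (Sum.inl (Sum.inr e)), q⟩

variable (y₁ : D₁.expansion.State) (z : P.Tuple [C]) (y₂ : D₂.expansion.State)
  (a : P.Tuple D₁.I) (c : P.Punctured D₂.I j)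

theorem mergeState_vertexLeft (x : D₁.expansion.V) :
    HEq (mergeState i j hB hC f hf y₁ z y₂ (vertexLeft D₁ D₂ i j hB hC f hf x)) (y₁ x) := by
  rcases x with x | x <;> rfl

theorem mergeState_vertexRight (x : D₂.expansion.V) :
    HEq (mergeState i j hB hC f hf y₁ z y₂ (vertexRight D₁ D₂ i j hB hC f hf x)) (y₂ x) := by
  rcases x with x | x <;> rfl

/-- Connecting uses up an output slot of `D₁` but none of its inputs: every input slot keeps its
supplier, so neither `z`, `y₂` nor `c` is read. -/
theorem vertexInput_inSlotLeft (p : Σ a : D₁.expansion.V, Fin (D₁.expansion.inp a).length) :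
    HEq ((D₁.connectExpansion D₂ i j hB hC f hf).vertexInput
        (inSlotLeft i j hB hC f hf p).1 (BorelObjects.plugIn c a)
        (mergeState i j hB hC f hf y₁ z y₂) (inSlotLeft i j hB hC f hf p).2)
      (D₁.expansion.vertexInput p.1 a y₁ p.2) := by
  -- The slot is the entry of an interface vertex, the end of the second half of a wire, or
  -- external.
  obtain ⟨(e | e) | s, rfl⟩ := D₁.expansion.in_bij.surjective p
  · exact (KSCDiagram.vertexInput_tgt_heq (D₁.connectExpansion D₂ i j hB hC f hf) _ _
      (Sum.inl (Sum.inl (Sum.inl e)))).trans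
      (D₁.expansion.vertexInput_tgt_heq a y₁ (Sum.inl e)).symm
  · exact (KSCDiagram.vertexInput_tgt_heq (D₁.connectExpansion D₂ i j hB hC f hf) _ _
      (Sum.inr (Sum.inl (Sum.inl e)))).trans
      (D₁.expansion.vertexInput_tgt_heq a y₁ (Sum.inr e)).symm
  · refine (KSCDiagram.vertexInput_heq_of_extIn (D₁.connectExpansion D₂ i j hB hC f hf) _ _
      (s := plugEquiv D₂.I j D₁.I (Sum.inl s)) ?_).trans
      ((BorelObjects.plugIn_apply_inl_heq c a s).trans
        (D₁.expansion.vertexInput_extIn_heq a y₁ s).symm)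
    exact congrArg (slotInl _ _) (connect_extIn_inl D₁ D₂ i j hB hC f hf s)

/-- Only the supplier of the external slot `j` changes: it now receives the value `z` of the
connecting interface vertex. The second diagram thus runs as if its external input were `T_j(𝐜_{-j},
z)`. -/
theorem vertexInput_inSlotRight (p : Σ a : D₂.expansion.V, Fin (D₂.expansion.inp a).length) :
    HEq ((D₁.connectExpansion D₂ i j hB hC f hf).vertexInput
        (inSlotRight i j hB hC f hf p).1 (BorelObjects.plugIn c a)
        (mergeState i j hB hC f hf y₁ z y₂) (inSlotRight i j hB hC f hf p).2)
      (D₂.expansion.vertexInput p.1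
        (BorelObjects.insertAt c (P.castOb hC.symm (P.unsingle z))) y₂ p.2) := by
  obtain ⟨(e | e) | s, rfl⟩ := D₂.expansion.in_bij.surjective p
  · exact (KSCDiagram.vertexInput_tgt_heq (D₁.connectExpansion D₂ i j hB hC f hf) _ _
      (Sum.inl (Sum.inl (Sum.inr e)))).trans
      (D₂.expansion.vertexInput_tgt_heq _ y₂ (Sum.inl e)).symm
  · exact (KSCDiagram.vertexInput_tgt_heq (D₁.connectExpansion D₂ i j hB hC f hf) _ _
      (Sum.inr (Sum.inl (Sum.inr e)))).trans
      (D₂.expansion.vertexInput_tgt_heq _ y₂ (Sum.inr e)).symm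
  · refine HEq.trans ?_ (D₂.expansion.vertexInput_extIn_heq _ y₂ s).symm
    by_cases hs : s = j
    -- The slot `j` is the target of the second half of the new wire, while in `D₂` alone it reads
    -- the inserted value.
    · subst hs
      exact (KSCDiagram.vertexInput_tgt_heq (D₁.connectExpansion D₂ i s hB hC f hf) _ _
        (Sum.inr (Sum.inr PUnit.unit))).trans ((BorelObjects.castOb_heq _ _).symm.trans
          (BorelObjects.insertAt_apply_self_heq c (P.castOb hC.symm (P.unsingle z))).symm)
    · refine HEq.trans ?_ (heq_of_eq (BorelObjects.insertAt_apply_ne c _ ⟨s, hs⟩)).symm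
      refine (KSCDiagram.vertexInput_heq_of_extIn (D₁.connectExpansion D₂ i j hB hC f hf) _ _
        (s := plugEquiv D₂.I j D₁.I (Sum.inr ⟨s, hs⟩)) ?_).trans
        (BorelObjects.plugIn_apply_inr_heq c a ⟨s, hs⟩)
      exact congrArg (slotInl _ _) (connect_extIn_inr D₁ D₂ i j hB hC f hf ⟨s, hs⟩)

theorem vertexInput_vertexMid :
    (D₁.connectExpansion D₂ i j hB hC f hf).vertexInput (vertexMid D₁ D₂ i j hB hC f hf)
        (BorelObjects.plugIn c a) (mergeState i j hB hC f hf y₁ z y₂) =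
      P.single (P.castOb hB (D₁.expansion.stateOutput y₁ i)) := by
  funext q
  obtain rfl : q = (0 : Fin 1) := Subsingleton.elim (α := Fin 1) _ _
  refine eq_of_heq ((KSCDiagram.vertexInput_tgt_heq (D₁.connectExpansion D₂ i j hB hC f hf) _ _
    (Sum.inl (Sum.inr PUnit.unit))).trans ?_)
  exact ((BorelObjects.castOb_heq _ _).trans ((BorelObjects.castOb_heq hB _).trans
    (D₁.expansion.stateOutput_heq y₁ i rfl))).symm

theorem stateOutput_mergeState :
    (D₁.connectExpansion D₂ i j hB hC f hf).stateOutput (mergeState i j hB hC f hf y₁ z y₂) =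
      BorelObjects.plugIn (BorelObjects.omit1 i (D₁.expansion.stateOutput y₁))
        (D₂.expansion.stateOutput y₂) := by
  funext r
  obtain ⟨s | s, rfl⟩ := (plugEquiv D₁.O i D₂.O).surjective r
  · refine eq_of_heq (HEq.trans ?_ (BorelObjects.plugIn_apply_inl_heq _ _ s).symm)
    exact (KSCDiagram.stateOutput_heq (D₁.connectExpansion D₂ i j hB hC f hf)
      (mergeState i j hB hC f hf y₁ z y₂) _ (p := slotInl _ _ (slotInr _ _ (D₂.extOut s)))
      (congrArg (slotInl _ _) (connect_extOut_inl D₁ D₂ i j hB hC f hf s))).trans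
      (D₂.expansion.stateOutput_heq y₂ s rfl).symm
  · refine eq_of_heq (HEq.trans ?_ (BorelObjects.plugIn_apply_inr_heq _ _ s).symm)
    exact (KSCDiagram.stateOutput_heq (D₁.connectExpansion D₂ i j hB hC f hf)
      (mergeState i j hB hC f hf y₁ z y₂) _ (p := slotInl _ _ (slotInl _ _ (D₁.extOut s.1)))
      (congrArg (slotInl _ _) (connect_extOut_inr D₁ D₂ i j hB hC f hf s))).trans
      (D₁.expansion.stateOutput_heq y₁ s.1 rfl).symm

/-! ### Each resampling in the connection acts on one component of a merged state. -/

open Classical in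
theorem resample_vertexLeft (x : D₁.expansion.V)
    (g : (D₁.connectExpansion D₂ i j hB hC f hf).State → ENNReal) :
    (D₁.connectExpansion D₂ i j hB hC f hf).resample (BorelObjects.plugIn c a)
        (vertexLeft D₁ D₂ i j hB hC f hf x) g (mergeState i j hB hC f hf y₁ z y₂) =
      D₁.expansion.resample a x
        (fun y => g (mergeState i j hB hC f hf y z y₂)) y₁ := by
  have hin := vertexInput_inSlotLeft i j hB hC f hf y₁ z y₂ a c
  have hup : ∀ (t : P.Tuple (D₁.expansion.out x))
      (t' : P.Tuple ((D₁.connectExpansion D₂ i j hB hC f hf).out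
        (vertexLeft D₁ D₂ i j hB hC f hf x))), HEq t t' →
      Function.update (mergeState i j hB hC f hf y₁ z y₂)
          (vertexLeft D₁ D₂ i j hB hC f hf x) t' =
        mergeState i j hB hC f hf (Function.update y₁ x t) z y₂ := by
    intro t t' ht
    refine Function.update_eq_iff.2 ⟨?_, fun b hb => ?_⟩
    · exact eq_of_heq (ht.symm.trans ((heq_of_eq (Function.update_self x t y₁).symm).trans
        (mergeState_vertexLeft i j hB hC f hf _ _ _ x).symm))
    · rcases connect_vertex_cases D₁ D₂ i j hB hC f hf b with ⟨b, rfl⟩ | ⟨b, rfl⟩ | rfl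
      · have hne : b ≠ x := fun h => hb (by rw [h])
        exact eq_of_heq ((mergeState_vertexLeft i j hB hC f hf _ _ _ b).trans ((heq_of_eq
          (Function.update_of_ne hne t y₁).symm).trans
          (mergeState_vertexLeft i j hB hC f hf _ _ _ b).symm))
      · exact eq_of_heq ((mergeState_vertexRight i j hB hC f hf _ _ _ b).trans
          (mergeState_vertexRight i j hB hC f hf _ _ _ b).symm)
      · rfl
  rcases x with x | x
  · exact (congrArg (fun k => ∫⁻ t, g (Function.update (mergeState i j hB hC f hf y₁ z y₂)
        (vertexLeft D₁ D₂ i j hB hC f hf (Sum.inl x)) t) ∂(D₁.expansion.ker (Sum.inl x) k))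
      (funext fun q => eq_of_heq (hin ⟨Sum.inl x, q⟩))).trans
      (lintegral_congr fun t => congrArg g (hup t t HEq.rfl))
  · exact (congrArg (fun k => ∫⁻ t, g (Function.update (mergeState i j hB hC f hf y₁ z y₂)
        (vertexLeft D₁ D₂ i j hB hC f hf (Sum.inr x)) t) ∂(D₁.expansion.ker (Sum.inr x) k))
      (funext fun q => eq_of_heq (hin ⟨Sum.inr x, q⟩))).trans
      (lintegral_congr fun t => congrArg g (hup t t HEq.rfl))

-- The external input of `D₂` on the right depends on the interface value `z`. It stays fixed while
-- the vertices of `D₂` are resampled, because these never change `z`.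
open Classical in
theorem resample_vertexRight (x : D₂.expansion.V)
    (g : (D₁.connectExpansion D₂ i j hB hC f hf).State → ENNReal) :
    (D₁.connectExpansion D₂ i j hB hC f hf).resample (BorelObjects.plugIn c a)
        (vertexRight D₁ D₂ i j hB hC f hf x) g (mergeState i j hB hC f hf y₁ z y₂) =
      D₂.expansion.resample (BorelObjects.insertAt c (P.castOb hC.symm (P.unsingle z))) x
        (fun y => g (mergeState i j hB hC f hf y₁ z y)) y₂ := by
  have hin := vertexInput_inSlotRight i j hB hC f hf y₁ z y₂ a c
  have hup : ∀ (t : P.Tuple (D₂.expansion.out x))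
      (t' : P.Tuple ((D₁.connectExpansion D₂ i j hB hC f hf).out
        (vertexRight D₁ D₂ i j hB hC f hf x))), HEq t t' →
      Function.update (mergeState i j hB hC f hf y₁ z y₂)
          (vertexRight D₁ D₂ i j hB hC f hf x) t' =
        mergeState i j hB hC f hf y₁ z (Function.update y₂ x t) := by
    intro t t' ht
    refine Function.update_eq_iff.2 ⟨?_, fun b hb => ?_⟩
    · exact eq_of_heq (ht.symm.trans ((heq_of_eq (Function.update_self x t y₂).symm).trans
        (mergeState_vertexRight i j hB hC f hf _ _ _ x).symm))
    · rcases connect_vertex_cases D₁ D₂ i j hB hC f hf b with ⟨b, rfl⟩ | ⟨b, rfl⟩ | rfl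
      · exact eq_of_heq ((mergeState_vertexLeft i j hB hC f hf _ _ _ b).trans
          (mergeState_vertexLeft i j hB hC f hf _ _ _ b).symm)
      · have hne : b ≠ x := fun h => hb (by rw [h])
        exact eq_of_heq ((mergeState_vertexRight i j hB hC f hf _ _ _ b).trans ((heq_of_eq
          (Function.update_of_ne hne t y₂).symm).trans
          (mergeState_vertexRight i j hB hC f hf _ _ _ b).symm))
      · rfl
  -- After the split into original and interface vertices, the profiles and kernels in the two
  -- diagrams agree definitionally, so the values match without casts.
  rcases x with x | x
  · exact (congrArg (fun k => ∫⁻ t, g (Function.update (mergeState i j hB hC f hf y₁ z y₂)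
        (vertexRight D₁ D₂ i j hB hC f hf (Sum.inl x)) t) ∂(D₂.expansion.ker (Sum.inl x) k))
      (funext fun q => eq_of_heq (hin ⟨Sum.inl x, q⟩))).trans
      (lintegral_congr fun t => congrArg g (hup t t HEq.rfl))
  · exact (congrArg (fun k => ∫⁻ t, g (Function.update (mergeState i j hB hC f hf y₁ z y₂)
        (vertexRight D₁ D₂ i j hB hC f hf (Sum.inr x)) t) ∂(D₂.expansion.ker (Sum.inr x) k))
      (funext fun q => eq_of_heq (hin ⟨Sum.inr x, q⟩))).trans
      (lintegral_congr fun t => congrArg g (hup t t HEq.rfl))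

open Classical in
theorem resample_vertexMid (g : (D₁.connectExpansion D₂ i j hB hC f hf).State → ENNReal) :
    (D₁.connectExpansion D₂ i j hB hC f hf).resample (BorelObjects.plugIn c a)
        (vertexMid D₁ D₂ i j hB hC f hf) g (mergeState i j hB hC f hf y₁ z y₂) =
      ∫⁻ t, g (mergeState i j hB hC f hf y₁ t y₂)
        ∂(P.κ f hf (P.single (P.castOb hB (D₁.expansion.stateOutput y₁ i)))) := by
  have hup : ∀ t : P.Tuple [C],
      Function.update (mergeState i j hB hC f hf y₁ z y₂) (vertexMid D₁ D₂ i j hB hC f hf) t =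
        mergeState i j hB hC f hf y₁ t y₂ := by
    refine fun t => Function.update_eq_iff.2 ⟨rfl, ?_⟩
    rintro ((b | b) | ((b | b) | b)) hb
    · rfl
    · rfl
    · rfl
    · rfl
    · exact absurd rfl hb
  exact (congrArg (fun k => ∫⁻ t, g (Function.update (mergeState i j hB hC f hf y₁ z y₂)
      (vertexMid D₁ D₂ i j hB hC f hf) t) ∂(P.κ f hf k))
    (vertexInput_vertexMid i j hB hC f hf y₁ z y₂ a c)).trans
    (lintegral_congr fun t => congrArg g (hup t))

/-- Sampling a connection samples the first diagram, then the connecting interface vertex, then the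
second diagram. -/
theorem expect_connectList (g : (D₁.connectExpansion D₂ i j hB hC f hf).State → ENNReal)
    (l₁ : List D₁.expansion.V) (l₂ : List D₂.expansion.V) :
    (D₁.connectExpansion D₂ i j hB hC f hf).expect (BorelObjects.plugIn c a)
        (connectList D₁ D₂ i j hB hC f hf l₁ l₂) g (mergeState i j hB hC f hf y₁ z y₂) =
      D₁.expansion.expect a l₁ (fun y => ∫⁻ t,
        D₂.expansion.expect (BorelObjects.insertAt c (P.castOb hC.symm (P.unsingle t))) l₂
          (fun y' => g (mergeState i j hB hC f hf y t y')) y₂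
        ∂(P.κ f hf (P.single (P.castOb hB (D₁.expansion.stateOutput y i))))) y₁ := by
  refine (congrFun (KSCDiagram.expect_append (D₁.connectExpansion D₂ i j hB hC f hf) _ g _ _)
    _).trans ?_
  -- During the first block `z` and `y₂` stay at their initial values; during the last block, the
  -- state `y` of `D₁` and the interface value `t` are frozen.
  refine (KSCDiagram.expect_map _ _ (fun y => mergeState i j hB hC f hf y z y₂)
    (fun x g y => resample_vertexLeft i j hB hC f hf y z y₂ a c x g) _ l₁ y₁).trans ?_
  refine congrArg (fun h => D₁.expansion.expect a l₁ h y₁) (funext fun y => ?_)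
  refine (resample_vertexMid i j hB hC f hf y z y₂ a c _).trans (lintegral_congr fun t => ?_)
  exact KSCDiagram.expect_map _ _ (fun y' => mergeState i j hB hC f hf y t y')
    (fun x g y' => resample_vertexRight i j hB hC f hf y t y' a c x g) _ l₂ y₂

theorem exists_mergeState (y : (D₁.connectExpansion D₂ i j hB hC f hf).State) :
    ∃ y₁ z y₂, mergeState i j hB hC f hf y₁ z y₂ = y := by
  refine ⟨fun b => match b with
      | Sum.inl b => y (Sum.inl (Sum.inl b))
      | Sum.inr e => y (Sum.inr (Sum.inl (Sum.inl e))),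
    y (Sum.inr (Sum.inr PUnit.unit)), fun b => match b with
      | Sum.inl b => y (Sum.inl (Sum.inr b))
      | Sum.inr e => y (Sum.inr (Sum.inl (Sum.inr e))), ?_⟩
  funext b
  rcases b with (b | b) | ((b | b) | b) <;> rfl

end CMP.Diagram

end MarkovPoly

/-! ### Assembly of the integral formula. -/

theorem mainTheorem6 {𝒞 : MarkovPoly.ColorSystem.{uK, vK, wM}} (P : MarkovPoly.CMP.{u, v} 𝒞)
    (D₁ D₂ : MarkovPoly.CMP.Diagram.{u, v, w} P)
    (i : Fin D₁.O.length) (j : Fin D₂.I.length) (B C : P.Ob)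
    (hB : D₁.O.get i = B) (hC : D₂.I.get j = C)
    (f : P.χ B ⟶ P.χ C) (hf : f ∈ P.Int B C) :
    (D₁.connect D₂ i j hB hC f hf).traceKernel =
      P.cksc D₁.traceKernel i hB f hf D₂.traceKernel j hC := by
  open MarkovPoly BorelObjects in
  have hκ : IsMarkovKernel (P.κ f hf) := P.isMarkov (P.κ_mem f hf)
  let E := D₁.connectExpansion D₂ i j hB hC f hf
  obtain ⟨σ₁⟩ := D₁.expansion.nonempty_topOrder
  obtain ⟨σ₂⟩ := D₂.expansion.nonempty_topOrder
  refine Kernel.ext fun x => Measure.ext fun S hS => ?_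
  obtain ⟨c, a, rfl⟩ : ∃ (c : P.Punctured D₂.I j) (a : P.Tuple D₁.I), plugIn c a = x :=
    ⟨outer x, inner x, plugIn_outer_inner x⟩
  obtain ⟨y⟩ := E.nonempty_state (plugIn c a)
  -- The components of one initial state of the connection also serve as initial states for the two
  -- separate diagrams.
  obtain ⟨y₁, z, y₂, rfl⟩ := CMP.Diagram.exists_mergeState i j hB hC f hf y
  have hS' : Measurable (S.indicator (1 : P.Tuple (plug D₁.O i D₂.O) → ENNReal)) :=
    measurable_one.indicator hS
  have hm : Measurable fun p : P.Tuple D₁.O × P.Tuple D₂.O =>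
      S.indicator (1 : P.Tuple (plug D₁.O i D₂.O) → ENNReal) (plugIn (omit1 i p.1) p.2) :=
    hS'.comp (measurable_plugIn.comp (((measurable_omit1 i).comp measurable_fst).prodMk
      measurable_snd))
  -- This is the integrand left for `D₁` once the interface and `D₂` are integrated out;
  -- `lintegral_traceKernel` accepts only measurable test functions.
  have hpost : Measurable fun b : P.Tuple D₁.O => ∫⁻ t, ∫⁻ d,
      S.indicator (1 : P.Tuple (plug D₁.O i D₂.O) → ENNReal) (plugIn (omit1 i b) d)
      ∂(D₂.traceKernel (insertAt c (P.castOb hC.symm (P.unsingle t))))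
      ∂(P.κ f hf (P.single (P.castOb hB (b i)))) := by
    have h1 : Measurable fun t : P.Tuple [C] => insertAt c (P.castOb hC.symm (P.unsingle t)) :=
      measurable_insertAt.comp (measurable_const.prodMk
        ((P.measurable_castOb hC.symm).comp P.measurable_unsingle))
    have h2 : Measurable fun b : P.Tuple D₁.O => P.single (P.castOb hB (b i)) :=
      P.measurable_single.comp ((P.measurable_castOb hB).comp (measurable_pi_apply i))
    have h3 : Measurable fun p : P.Tuple D₁.O × P.Tuple [C] => ∫⁻ d,
        S.indicator (1 : P.Tuple (plug D₁.O i D₂.O) → ENNReal) (plugIn (omit1 i p.1) d)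
        ∂(D₂.traceKernel (insertAt c (P.castOb hC.symm (P.unsingle p.2)))) :=
      Measurable.lintegral_kernel_prod_right'
        (κ := D₂.traceKernel.comap _ (h1.comp (measurable_snd (α := P.Tuple D₁.O))))
        (hm.comp ((measurable_fst.comp measurable_fst).prodMk measurable_snd))
    exact Measurable.lintegral_kernel_prod_right' (κ := (P.κ f hf).comap _ h2) h3
  refine Eq.trans ?_ (kscVia_apply D₁.traceKernel i hB (P.κ f hf) D₂.traceKernel j hC hS a c).symm
  refine Eq.trans ?_ (D₁.expansion.lintegral_traceKernel σ₁.nodup_toList σ₁.mem_toList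
    σ₁.isTopSorted_toList a y₁ hpost).symm
  rw [← lintegral_indicator_one hS]
  refine (E.lintegral_traceKernel (CMP.Diagram.nodup_connectList i j hB hC f hf σ₁.nodup_toList
    σ₂.nodup_toList) (CMP.Diagram.mem_connectList i j hB hC f hf σ₁.mem_toList σ₂.mem_toList)
    (CMP.Diagram.isTopSorted_connectList i j hB hC f hf σ₁.isTopSorted_toList
      σ₂.isTopSorted_toList) (plugIn c a)
    (CMP.Diagram.mergeState i j hB hC f hf y₁ z y₂) hS').trans ?_
  refine (CMP.Diagram.expect_connectList i j hB hC f hf y₁ z y₂ a c _ _ _).trans ?_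
  refine congrArg (fun h => D₁.expansion.expect a σ₁.toList h y₁) (funext fun y =>
    lintegral_congr fun t => ?_)
  -- With `y` and `t` fixed, the merged output depends on the state of `D₂` only through its output
  -- tuple, so the inner expectation is an integral against the trace kernel of `D₂`.
  refine Eq.trans (congrArg (fun h => D₂.expansion.expect _ σ₂.toList h y₂) (funext fun y' =>
    congrArg (S.indicator 1) (CMP.Diagram.stateOutput_mergeState i j hB hC f hf y t y'))) ?_
  exact (D₂.expansion.lintegral_traceKernel σ₂.nodup_toList σ₂.mem_toList σ₂.isTopSorted_toList
    _ y₂ (hm.comp measurable_prodMk_left)).symm
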